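/- Let $N\ge 2$ be an integer. For $\beta\in(1/(2N-1),1/N)$, a code of $t\in[-1,1]$ is a sequence $(j_\ell)_{\ell\ge1}$ with $j_\ell\in\{0,\pm1,\dots,\pm(N-1)\}$ for all $\ell$ and $$t=\sum_{\ell=1}^\infty \frac{j_\ell\,\beta^{\ell-1}(1-\beta)}{N-1},$$ and $\mathcal U_{\beta,\pm N}$ denotes the set of all $t\in[-1,1]$ that have exactly one code. Define the Thue–Morse-type sequence $(\lambda_\ell)_{\ell\ge1}$ in $\{0,1,\dots,2N-2\}$ by $$\lambda_1=N,\qquad \lambda_{2^{n+1}}=2N-1-\lambda_{2^n}\quad(n\ge0),\qquad \lambda_{2^n+\ell}=2N-2-\lambda_\ell\quad(1\le\ell<2^n,\ n\ge1).$$ Then the equation $1=\sum_{\ell=1}^\infty\lambda_\ell\beta^\ell$ has exactly one positive real solution $\beta_c$, this solution satisfies $\beta_c\in(1/(2N-1),1/N)$, and the following hold. 1. If $\beta\in(1/(2N-1),\beta_c)$, then $\dim_H\mathcal U_{\beta,\pm N}>0$. 2. If $\beta=\beta_c$, then $|\mathcal U_{\beta_c,\pm N}|=2^{\aleph_0}$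 and $\dim_H\mathcal U_{\beta_c,\pm N}=0$. 3. If $\beta\in(\beta_c,1/N)$, then $|\mathcal U_{\beta,\pm N}|=\aleph_0$. Here $\dim_H$ denotes Hausdorff dimension. -/

import Mathlib

open scoped Cardinal

noncomputable section

/-- The digit set `{0, ±1, …, ±(N - 1)}`. -/
def digitSet (N : ℕ) : Set ℤ := Set.Icc (-((N : ℤ) - 1)) ((N : ℤ) - 1)

/-- `j` is a code of `t` with digit set `{0, ±1, …, ±(N - 1)}`: all its terms are digits and
`t = ∑ j_ℓ β ^ (ℓ - 1) (1 - β) / (N - 1)`, summed over `ℓ ≥ 1`. The term `j_ℓ` of the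
mathematical sequence is `j (ℓ - 1)` here. -/
def IsCode (N : ℕ) (β : ℝ) (j : ℕ → ℤ) (t : ℝ) : Prop :=
  (∀ ℓ, j ℓ ∈ digitSet N) ∧
    HasSum (fun ℓ : ℕ => (j ℓ : ℝ) * β ^ ℓ * (1 - β) / ((N : ℝ) - 1)) t

/-- The set of all `t ∈ [-1, 1]` with exactly one code. -/
def uniqueCodeSet (N : ℕ) (β : ℝ) : Set ℝ :=
  {t | t ∈ Set.Icc (-1 : ℝ) 1 ∧ ∃! j : ℕ → ℤ, IsCode N β j t}

/-- The Thue–Morse type sequence `(λ_ℓ)`, `ℓ ≥ 1`, over `{0, …, 2 N - 2}`, given by `λ_1 = N`,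
`λ_{2^(n+1)} = 2 N - 1 - λ_{2^n}` for `n ≥ 0`, and `λ_{2^n + ℓ} = 2 N - 2 - λ_ℓ` for
`1 ≤ ℓ < 2^n`, `n ≥ 1`; see the three lemmas below. The value at `0` is irrelevant.
Note that `2 ^ Nat.log 2 ℓ` is the largest power of two that is at most `ℓ`. -/
def lam (N : ℕ) : ℕ → ℤ
  | 0 => 0
  | 1 => N
  | ℓ + 2 =>
    if ℓ + 2 = 2 ^ Nat.log 2 (ℓ + 2) then 2 * (N : ℤ) - 1 - lam N ((ℓ + 2) / 2)
    else 2 * (N : ℤ) - 2 - lam N (ℓ + 2 - 2 ^ Nat.log 2 (ℓ + 2))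
  termination_by ℓ => ℓ
  decreasing_by
    · omega
    · have : 0 < 2 ^ Nat.log 2 (ℓ + 2) := by positivity
      omega

theorem lam_one (N : ℕ) : lam N 1 = N := by
  rw [lam]

theorem lam_two_pow_succ (N n : ℕ) : lam N (2 ^ (n + 1)) = 2 * (N : ℤ) - 1 - lam N (2 ^ n) := by
  obtain ⟨m, hm⟩ : ∃ m, 2 ^ (n + 1) = m + 2 :=
    ⟨2 ^ (n + 1) - 2, by have : 0 < 2 ^ n := by positivity
                         omega⟩
  have hl : m + 2 = 2 ^ Nat.log 2 (m + 2) := by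
    rw [← hm, Nat.log_pow (by norm_num)]
  have hd : (m + 2) / 2 = 2 ^ n := by omega
  rw [hm, lam, if_pos hl, hd]

theorem lam_two_pow_add (N n ℓ : ℕ) (h1 : 1 ≤ ℓ) (h2 : ℓ < 2 ^ n) :
    lam N (2 ^ n + ℓ) = 2 * (N : ℤ) - 2 - lam N ℓ := by
  have hp : 0 < 2 ^ n := by positivity
  obtain ⟨m, hm⟩ : ∃ m, 2 ^ n + ℓ = m + 2 := ⟨2 ^ n + ℓ - 2, by omega⟩
  have hl : Nat.log 2 (m + 2) = n := by
    rw [← hm]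
    exact Nat.log_eq_of_pow_le_of_lt_pow (by omega) (by rw [pow_succ]; omega)
  have hne : m + 2 ≠ 2 ^ n := by omega
  have hd : m + 2 - 2 ^ n = ℓ := by omega
  rw [hm, lam, hl, if_neg hne, hd]

end

/-!
Two digit sequences have the same value exactly if, behind their first disagreement, the values of
the tails compensate for the difference of the digits. Since every number in the range `[-R, R]`,
`R = (N - 1) / (1 - β)`, is the value of some digit sequence (`Admissible.exists_val_eq`), a
sequence is the only code of its point if and only if every tail behind a non-maximal digit has a
value below `c = 1 / β - R`, and every tail behind a non-minimal digit a value above `-c`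
(`Univoque`). Apart from the two constant sequences with extreme digits, such a sequence ends up
with all tails strictly between `-c` and `c` (`Trapped`). As `β c < 1 / 2`, lexicographic and
numerical comparison of such sequences agree.

Put `μ_i = λ_i - (N - 1)`. This is the difference sequence of the Thue–Morse sequence `τ`,
whatever `N` is (`mu_eq_diff`), and `1 = ∑ λ_i β ^ i` says that `c` is the value of `μ`. So `β` is
below, at or above the critical parameter according to whether `val μ < c`, `val μ = c` or `c <
val μ`.

*Upper bounds.* If `c ≤ val μ`, then all tails of a trapped sequence lie lexicographically between
`-μ` and `μ`. If the block `w = μ_1 … μ_{2^n}` occurs up to sign in such a sequence, then the two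
bounds pin down the next `2 ^ n` terms to two possibilities: either the block `μ_1 … μ_{2^{n+1}}`
occurs, or `w` is followed by `-w` (`LexBounded.occurs_succ_or`). Hence a sequence in which not
all of these blocks occur up to sign is eventually zero or eventually `±(w (-w))^∞` for some `n`,
and there are only countably many of those. For `c < val μ` long blocks cannot occur, which gives
countability. For `c = val μ` the remaining sequences are, for every `n`, concatenations of four
kinds of blocks of length `2 ^ n` behind a finite prefix (`LexBounded.eq_block`), so that their
values form a set of dimension at most `log 4 / (2 ^ n log (1 / β))`.

*Lower bounds.* The difference sequence of a binary sequence `x` is trapped if the tails of `x`,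
complemented so that they start with `0`, have values small compared with that of `τ`. The
substitution `0 ↦ 01`, `1 ↦ 10`, which fixes `τ`, doubles the number of places for which these
tails are known to be lexicographically at most `τ` (`TailsLe.subst`), and that number is at least
three for every binary sequence. If `val μ < c`, then the images of all binary sequences under a
high iterate of the substitution are therefore trapped, and they give a set of positive dimension.
If `val μ = c`, then infinite compositions of the substitution with optional doublings of the
first term give continuum many sequences whose tails are lexicographically at most `τ`, all but
countably many of them strictly.
-/

/-! ### Power series with bounded integer coefficients -/

/-- The sequence `s` with its first `n` terms dropped. -/
def shift {α : Type*} (n : ℕ) (s : ℕ → α) : ℕ → α := fun i => s (i + n)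

/-- The value `∑ s_i β ^ i`, `i ≥ 0`, of an integer sequence. -/
noncomputable def val (β : ℝ) (s : ℕ → ℤ) : ℝ := ∑' i, (s i : ℝ) * β ^ i

/-- All terms of `s` are at most `C` in absolute value. -/
def BddBy (C : ℤ) (s : ℕ → ℤ) : Prop := ∀ i, |s i| ≤ C

theorem shift_shift {α : Type*} (m n : ℕ) (s : ℕ → α) : shift m (shift n s) = shift (m + n) s := by
  funext i
  simp [shift, add_assoc]

@[simp] theorem shift_zero {α : Type*} (s : ℕ → α) : shift 0 s = s := rfl

theorem shift_neg (n : ℕ) (s : ℕ → ℤ) : shift n (-s) = -shift n s := rfl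

theorem BddBy.shift {C : ℤ} {s : ℕ → ℤ} (h : BddBy C s) (n : ℕ) : BddBy C (shift n s) :=
  fun i => h (i + n)

theorem BddBy.neg {C : ℤ} {s : ℕ → ℤ} (h : BddBy C s) : BddBy C (-s) :=
  fun i => by simpa using h i

theorem BddBy.abs_term_le {C : ℤ} {s : ℕ → ℤ} (h : BddBy C s) {β : ℝ} (h0 : 0 < β) (i : ℕ) :
    ‖(s i : ℝ) * β ^ i‖ ≤ C * β ^ i := by
  have : |(s i : ℝ)| ≤ C := by exact_mod_cast h i
  rw [norm_mul, Real.norm_eq_abs, Real.norm_eq_abs, abs_of_pos (pow_pos h0 i)]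
  gcongr

theorem BddBy.summable {C : ℤ} {s : ℕ → ℤ} (h : BddBy C s) {β : ℝ} (h0 : 0 < β) (h1 : β < 1) :
    Summable fun i => (s i : ℝ) * β ^ i :=
  Summable.of_norm_bounded ((summable_geometric_of_lt_one h0.le h1).mul_left (C : ℝ))
    (h.abs_term_le h0)

theorem BddBy.hasSum {C : ℤ} {s : ℕ → ℤ} (h : BddBy C s) {β : ℝ} (h0 : 0 < β) (h1 : β < 1) :
    HasSum (fun i => (s i : ℝ) * β ^ i) (val β s) :=
  (h.summable h0 h1).hasSum

theorem BddBy.abs_val_le {C : ℤ} {s : ℕ → ℤ} (h : BddBy C s) {β : ℝ} (h0 : 0 < β) (h1 : β < 1) :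
    |val β s| ≤ C / (1 - β) := by
  have hs := (hasSum_geometric_of_lt_one h0.le h1).mul_left (C : ℝ)
  exact tsum_of_norm_bounded hs (h.abs_term_le h0)

theorem val_neg (β : ℝ) (s : ℕ → ℤ) : val β (-s) = -val β s := by
  simp [val, tsum_neg]

theorem BddBy.val_split {C : ℤ} {s : ℕ → ℤ} (h : BddBy C s) {β : ℝ} (h0 : 0 < β) (h1 : β < 1)
    (n : ℕ) : val β s =
      ∑ i ∈ Finset.range n, (s i : ℝ) * β ^ i + β ^ n * val β (_root_.shift n s) := by
  rw [val, ← (h.summable h0 h1).sum_add_tsum_nat_add n, val, ← tsum_mul_left]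
  congr 2
  funext i
  simp only [_root_.shift, pow_add]
  ring

theorem BddBy.val_succ {C : ℤ} {s : ℕ → ℤ} (h : BddBy C s) {β : ℝ} (h0 : 0 < β) (h1 : β < 1) :
    val β s = s 0 + β * val β (_root_.shift 1 s) := by
  simpa using h.val_split h0 h1 1

theorem BddBy.val_shift {C : ℤ} {s : ℕ → ℤ} (h : BddBy C s) {β : ℝ} (h0 : 0 < β) (h1 : β < 1)
    (n : ℕ) : val β (_root_.shift n s) = s n + β * val β (_root_.shift (n + 1) s) := by
  rw [(h.shift n).val_succ h0 h1, shift_shift, add_comm 1 n]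
  simp [_root_.shift]

theorem val_sub_val_of_agree {C D : ℤ} {s r : ℕ → ℤ} (hs : BddBy C s) (hr : BddBy D r) {β : ℝ}
    (h0 : 0 < β) (h1 : β < 1) {n : ℕ} (h : ∀ k < n, s k = r k) :
    val β s - val β r = β ^ n * (val β (shift n s) - val β (shift n r)) := by
  rw [hs.val_split h0 h1 n, hr.val_split h0 h1 n,
    Finset.sum_congr rfl fun i hi => by rw [h i (Finset.mem_range.1 hi)]]
  ring

theorem exists_first_ne {α : Type*} {s r : ℕ → α} (h : s ≠ r) :
    ∃ n, (∀ k < n, s k = r k) ∧ s n ≠ r n := by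
  classical
  have hex : ∃ n, s n ≠ r n := Function.ne_iff.1 h
  exact ⟨Nat.find hex, fun k hk => not_not.1 (Nat.find_min hex hk), Nat.find_spec hex⟩

/-! ### The parameters -/

/-- `N ≥ 2` and `1 / (2 N - 1) < β < 1 / N`. -/
structure Admissible (N : ℕ) (β : ℝ) : Prop where
  two_le : 2 ≤ N
  mem : β ∈ Set.Ioo (1 / (2 * (N : ℝ) - 1)) (1 / (N : ℝ))

/-- The largest value `(N - 1) / (1 - β)` of a sequence with digits in `{0, ±1, …, ±(N - 1)}`. -/
noncomputable def radius (N : ℕ) (β : ℝ) : ℝ := ((N : ℝ) - 1) / (1 - β)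

/-- The number `1 / β - radius`. Raising a digit by one has to be compensated by lowering the value
of the tail behind it by `1 / β`, and the new value is at least `-radius` exactly if the old one is
at least this threshold. -/
noncomputable def threshold (N : ℕ) (β : ℝ) : ℝ := 1 / β - radius N β

namespace Admissible

variable {N : ℕ} {β : ℝ}

theorem two_le_cast (h : Admissible N β) : (2 : ℝ) ≤ N := by exact_mod_cast h.two_le

theorem one_lt_mul (h : Admissible N β) : 1 < (2 * (N : ℝ) - 1) * β := by
  have := h.two_le_cast
  have h2 := h.mem.1
  rw [div_lt_iff₀ (by linarith)] at h2
  linarith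

theorem mul_lt_one (h : Admissible N β) : (N : ℝ) * β < 1 := by
  have := h.two_le_cast
  have h2 := h.mem.2
  rw [lt_div_iff₀ (by linarith)] at h2
  linarith

theorem pos (h : Admissible N β) : 0 < β := by
  have := h.two_le_cast
  by_contra! hb
  have := h.one_lt_mul
  nlinarith

theorem lt_half (h : Admissible N β) : β < 1 / 2 := by
  have := h.two_le_cast
  have := h.mul_lt_one
  have := h.pos
  nlinarith

theorem lt_one (h : Admissible N β) : β < 1 := by linarith [h.lt_half]

theorem one_sub_mul_radius (h : Admissible N β) : (1 - β) * radius N β = N - 1 := by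
  have : 1 - β ≠ 0 := by linarith [h.lt_one]
  rw [radius]
  field_simp

theorem half_lt_mul_radius (h : Admissible N β) : 1 / 2 < β * radius N β := by
  have := h.lt_one
  rw [radius, mul_div_assoc', lt_div_iff₀ (by linarith)]
  linarith [h.one_lt_mul]

theorem mul_threshold (h : Admissible N β) : β * threshold N β = 1 - β * radius N β := by
  have := h.pos.ne'
  rw [threshold, mul_sub]
  field_simp

theorem mul_threshold_lt (h : Admissible N β) : β * threshold N β < 1 / 2 := by
  linarith [h.mul_threshold, h.half_lt_mul_radius]

theorem threshold_pos (h : Admissible N β) : 0 < threshold N β := by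
  have h1 := h.mul_threshold
  have h2 := h.one_sub_mul_radius
  have h3 := h.mul_lt_one
  have : 0 < β * threshold N β := by
    have h4 := h.lt_one
    have : (1 - β) * (1 - β * radius N β) > 0 := by
      have : (1 - β) * (1 - β * radius N β) = 1 - β - β * ((1 - β) * radius N β) := by ring
      rw [this, h2]
      linarith
    rw [h1]
    exact pos_of_mul_pos_right this (by linarith)
  exact pos_of_mul_pos_right this h.pos.le

theorem one_sub_mul_threshold (h : Admissible N β) : (1 - β) * threshold N β ≤ N - 1 := by
  have h1 := h.mul_threshold
  have h2 := h.one_sub_mul_radius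
  have h3 := h.one_lt_mul
  have h0 := h.pos
  have : β * ((1 - β) * threshold N β) ≤ β * (N - 1) := by
    calc β * ((1 - β) * threshold N β) = (1 - β) * (β * threshold N β) := by ring
      _ = 1 - β - β * ((1 - β) * radius N β) := by rw [h1]; ring
      _ ≤ _ := by rw [h2]; linarith
  exact le_of_mul_le_mul_left this h0

theorem abs_val_le (h : Admissible N β) {s : ℕ → ℤ} (hs : BddBy (N - 1) s) :
    |val β s| ≤ radius N β := by
  simpa [radius] using hs.abs_val_le h.pos h.lt_one

end Admissible

/-! ### Existence of codes -/

/-- Choosing the digit nearest to `x` keeps the remainder of an expansion within the radius. This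
uses `β ≥ 1 / (2 N - 1)`, which says that `1 / 2 ≤ β * radius`. -/
theorem Admissible.exists_digit {N : ℕ} {β : ℝ} (h : Admissible N β) {x : ℝ}
    (hx : |x| ≤ radius N β) : ∃ d : ℤ, |d| ≤ (N : ℤ) - 1 ∧ |(x - d) / β| ≤ radius N β := by
  have h0 := h.pos
  have h2 := h.half_lt_mul_radius
  have h3 := h.one_sub_mul_radius
  have hN := h.two_le
  suffices ∃ d : ℤ, |d| ≤ (N : ℤ) - 1 ∧ |x - d| ≤ β * radius N β by
    obtain ⟨d, hd, hxd⟩ := this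
    refine ⟨d, hd, ?_⟩
    rw [abs_div, abs_of_pos h0, div_le_iff₀ h0]
    linarith
  have hr := abs_le.1 (abs_sub_round x)
  rw [abs_le] at hx
  by_cases h4 : (N : ℤ) ≤ round x
  · have h5 : (N : ℝ) ≤ round x := by exact_mod_cast h4
    refine ⟨N - 1, abs_le.2 ⟨by omega, by omega⟩, ?_⟩
    push_cast
    rw [abs_le]
    constructor <;> linarith
  by_cases h6 : round x ≤ -(N : ℤ)
  · have h5 : (round x : ℝ) ≤ -N := by exact_mod_cast h6
    refine ⟨-(N - 1), abs_le.2 ⟨by omega, by omega⟩, ?_⟩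
    push_cast
    rw [abs_le]
    constructor <;> linarith
  · refine ⟨round x, by rw [abs_le]; constructor <;> omega, ?_⟩
    rw [abs_le]
    constructor <;> linarith

theorem Admissible.exists_val_eq {N : ℕ} {β : ℝ} (h : Admissible N β) {x : ℝ}
    (hx : |x| ≤ radius N β) : ∃ s : ℕ → ℤ, BddBy (N - 1) s ∧ val β s = x := by
  have h0 := h.pos
  choose! d hd1 hd2 using fun (y : ℝ) (hy : |y| ≤ radius N β) => h.exists_digit hy
  let T : ℝ → ℝ := fun y => (y - d y) / β
  have hT : ∀ n, |T^[n] x| ≤ radius N β := by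
    intro n
    induction n with
    | zero => exact hx
    | succ n ih => rw [Function.iterate_succ_apply']; exact hd2 _ ih
  have hs : BddBy (N - 1) fun n => d (T^[n] x) := fun n => hd1 _ (hT n)
  refine ⟨_, hs, ?_⟩
  have hpart : ∀ n, x =
      ∑ i ∈ Finset.range n, ((d (T^[i] x) : ℤ) : ℝ) * β ^ i + β ^ n * T^[n] x := by
    intro n
    induction n with
    | zero => simp
    | succ n ih =>
      rw [Finset.sum_range_succ, Function.iterate_succ_apply']
      have : β * T (T^[n] x) = T^[n] x - d (T^[n] x) := by
        simp only [T]
        field_simp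
      calc x = _ := ih
        _ = _ := by
          rw [pow_succ, mul_assoc (β ^ n) β, this]
          ring
  have hlim : Filter.Tendsto (fun n => β ^ n * T^[n] x) Filter.atTop (nhds 0) := by
    refine squeeze_zero_norm (a := fun n => β ^ n * radius N β) (fun n => ?_) ?_
    · rw [norm_mul, norm_pow, Real.norm_eq_abs, Real.norm_eq_abs, abs_of_pos h0]
      have := hT n
      gcongr
    · simpa using (tendsto_pow_atTop_nhds_zero_of_lt_one h0.le h.lt_one).mul_const (radius N β)
  have h1 := (hs.hasSum h0 h.lt_one).tendsto_sum_nat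
  have h2 := h1.add hlim
  rw [add_zero] at h2
  refine tendsto_nhds_unique h2 ?_
  exact tendsto_const_nhds.congr hpart

/-! ### Univoque sequences -/

/-- Digit sequences in which no digit can be increased or decreased by one with a compensating
change of the tail. These are the sequences that are the only code of their point. -/
structure Univoque (N : ℕ) (β : ℝ) (s : ℕ → ℤ) : Prop where
  bdd : BddBy (N - 1) s
  lt : ∀ n, s n < (N : ℤ) - 1 → val β (shift (n + 1) s) < threshold N β
  gt : ∀ n, -((N : ℤ) - 1) < s n → -threshold N β < val β (shift (n + 1) s)

/-- Digit sequences all of whose tails have a value below the threshold in absolute value. -/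
structure Trapped (N : ℕ) (β : ℝ) (s : ℕ → ℤ) : Prop where
  bdd : BddBy (N - 1) s
  abs_val_lt : ∀ n, |val β (shift n s)| < threshold N β

theorem Univoque.neg {N : ℕ} {β : ℝ} {s : ℕ → ℤ} (h : Univoque N β s) : Univoque N β (-s) where
  bdd := h.bdd.neg
  lt n hn := by
    have := h.gt n (by simp at hn; omega)
    rw [shift_neg, val_neg]
    linarith
  gt n hn := by
    have := h.lt n (by simp at hn; omega)
    rw [shift_neg, val_neg]
    linarith

theorem Trapped.univoque {N : ℕ} {β : ℝ} {s : ℕ → ℤ} (h : Trapped N β s) : Univoque N β s where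
  bdd := h.bdd
  lt _ _ := (abs_lt.1 (h.abs_val_lt _)).2
  gt _ _ := (abs_lt.1 (h.abs_val_lt _)).1

theorem Trapped.shift {N : ℕ} {β : ℝ} {s : ℕ → ℤ} (h : Trapped N β s) (n : ℕ) :
    Trapped N β (shift n s) where
  bdd := h.bdd.shift n
  abs_val_lt m := by rw [shift_shift]; exact h.abs_val_lt _

theorem Trapped.neg {N : ℕ} {β : ℝ} {s : ℕ → ℤ} (h : Trapped N β s) : Trapped N β (-s) where
  bdd := h.bdd.neg
  abs_val_lt n := by rw [shift_neg, val_neg, abs_neg]; exact h.abs_val_lt n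

/-- At the first disagreement of two digit sequences with the same value, the tail behind the
smaller digit has at least the threshold as its value. -/
theorem Univoque.not_lt_of_val_eq {N : ℕ} {β : ℝ} (h : Admissible N β) {s r : ℕ → ℤ}
    (hs : Univoque N β s) (hr : BddBy (N - 1) r) (heq : val β s = val β r) {n : ℕ}
    (hn : ∀ k < n, s k = r k) : ¬ s n < r n := by
  intro hlt
  have h0 := h.pos
  have h1 := h.lt_one
  have e := val_sub_val_of_agree hs.bdd hr h0 h1 hn
  rw [heq, sub_self, hs.bdd.val_shift h0 h1, hr.val_shift h0 h1, eq_comm, mul_eq_zero,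
    or_iff_right (pow_pos h0 n).ne'] at e
  have hrn := (abs_le.1 (hr n)).2
  have h2 := hs.lt n (by omega)
  have h3 := (abs_le.1 (h.abs_val_le (hr.shift (n + 1)))).1
  have h4 := h.mul_threshold
  have h5 : (s n : ℝ) + 1 ≤ r n := by exact_mod_cast hlt
  have h6 := mul_lt_mul_of_pos_left h2 h0
  have h7 := mul_le_mul_of_nonneg_left h3 h0.le
  linarith

theorem Univoque.eq_of_val_eq {N : ℕ} {β : ℝ} (h : Admissible N β) {s r : ℕ → ℤ}
    (hs : Univoque N β s) (hr : BddBy (N - 1) r) (heq : val β s = val β r) : s = r := by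
  by_contra hne
  obtain ⟨n, hn, hne⟩ := exists_first_ne hne
  rcases lt_or_gt_of_ne hne with hlt | hlt
  · exact hs.not_lt_of_val_eq h hr heq hn hlt
  · exact hs.neg.not_lt_of_val_eq h hr.neg (by rw [val_neg, val_neg, heq])
      (fun k hk => by simp [hn k hk]) (n := n) (by simpa using hlt)

theorem lt_threshold_of_unique {N : ℕ} {β : ℝ} (h : Admissible N β) {s : ℕ → ℤ}
    (hs : BddBy (N - 1) s) (huniq : ∀ r, BddBy (N - 1) r → val β r = val β s → r = s) (n : ℕ)
    (hn : s n < (N : ℤ) - 1) : val β (shift (n + 1) s) < threshold N β := by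
  by_contra! hge
  have h0 := h.pos
  have h1 := h.lt_one
  have hle := (abs_le.1 (h.abs_val_le (hs.shift (n + 1)))).2
  -- the tail that compensates for raising the `n`-th digit by one
  obtain ⟨r, hr, hrv⟩ := h.exists_val_eq (x := val β (shift (n + 1) s) - 1 / β) (by
    rw [threshold] at hge
    have : 0 < 1 / β := by positivity
    rw [abs_le]
    constructor <;> linarith)
  let q : ℕ → ℤ := fun i => if i < n then s i else if i = n then s n + 1 else r (i - (n + 1))
  have hq : BddBy (N - 1) q := by
    intro i
    simp only [q]
    have := abs_le.1 (hs n)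
    split_ifs
    · exact hs i
    · rw [abs_le]
      constructor <;> omega
    · exact hr _
  have hqtail : shift (n + 1) q = r := by
    funext i
    simp only [q, shift]
    rw [if_neg (by omega), if_neg (by omega)]
    congr 1
    omega
  have hqn : q n = s n + 1 := by simp [q]
  have e := val_sub_val_of_agree hq hs h0 h1 (n := n) fun k hk => by simp [q, hk]
  rw [hq.val_shift h0 h1, hs.val_shift h0 h1, hqtail, hrv, hqn] at e
  have e2 : val β q = val β s := by
    have : β * (1 / β) = 1 := by field_simp
    rw [← sub_eq_zero, e]
    push_cast
    linear_combination (-β ^ n) * this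
  have := congrFun (huniq q hq e2) n
  omega

theorem univoque_of_unique {N : ℕ} {β : ℝ} (h : Admissible N β) {s : ℕ → ℤ}
    (hs : BddBy (N - 1) s) (huniq : ∀ r, BddBy (N - 1) r → val β r = val β s → r = s) :
    Univoque N β s where
  bdd := hs
  lt := lt_threshold_of_unique h hs huniq
  gt n hn := by
    have := lt_threshold_of_unique h hs.neg (fun r hr hv => by
      rw [← neg_eq_iff_eq_neg]
      exact huniq _ hr.neg (by rw [val_neg, hv, val_neg, neg_neg])) n (by simp; omega)
    rw [shift_neg, val_neg] at this
    linarith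

/-- Once a tail of a univoque sequence has a value below the threshold, all later ones have. Where
the digit is maximal, univoqueness gives no bound, but then the value `v` of the tail turns into
`(v - (N - 1)) / β`, which is below the threshold too. -/
theorem Univoque.val_lt_of_val_lt {N : ℕ} {β : ℝ} (h : Admissible N β) {s : ℕ → ℤ}
    (hs : Univoque N β s) {n : ℕ} (hn : val β (shift n s) < threshold N β) {m : ℕ} (hm : n ≤ m) :
    val β (shift m s) < threshold N β := by
  induction m, hm using Nat.le_induction with
  | base => exact hn
  | succ m _ ih =>
    by_cases hd : s m < (N : ℤ) - 1
    · exact hs.lt m hd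
    · rw [hs.bdd.val_shift h.pos h.lt_one] at ih
      have h1 : (N : ℝ) - 1 ≤ s m := by
        have := not_lt.1 hd
        exact_mod_cast this
      have h2 := h.one_sub_mul_threshold
      have : β * val β (_root_.shift (m + 1) s) < β * threshold N β := by linarith
      exact lt_of_mul_lt_mul_left this h.pos.le

theorem Univoque.eventually_lt {N : ℕ} {β : ℝ} (h : Admissible N β) {s : ℕ → ℤ}
    (hs : Univoque N β s) : (s = fun _ => (N : ℤ) - 1) ∨
      ∃ k, ∀ m, k ≤ m → val β (shift m s) < threshold N β := by
  by_cases hc : ∃ n, s n < (N : ℤ) - 1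
  · obtain ⟨n, hn⟩ := hc
    exact Or.inr ⟨n + 1, fun m hm => hs.val_lt_of_val_lt h (hs.lt n hn) hm⟩
  · push Not at hc
    left
    funext n
    exact le_antisymm (abs_le.1 (hs.bdd n)).2 (hc n)

theorem Univoque.eventually_trapped {N : ℕ} {β : ℝ} (h : Admissible N β) {s : ℕ → ℤ}
    (hs : Univoque N β s) : (s = fun _ => (N : ℤ) - 1) ∨ (s = fun _ => -((N : ℤ) - 1)) ∨
      ∃ k, Trapped N β (shift k s) := by
  rcases hs.eventually_lt h with h1 | ⟨k, hk⟩
  · exact Or.inl h1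
  rcases hs.neg.eventually_lt h with h2 | ⟨l, hl⟩
  · right; left
    rw [neg_eq_iff_eq_neg] at h2
    exact h2
  · refine Or.inr (Or.inr ⟨k + l, hs.bdd.shift _, fun n => ?_⟩)
    rw [shift_shift, abs_lt]
    have e1 := hk (n + (k + l)) (by omega)
    have e2 := hl (n + (k + l)) (by omega)
    rw [shift_neg, val_neg] at e2
    constructor <;> linarith

/-! ### The set of points with a unique code -/

/-- The point whose code is `s`. -/
noncomputable def codePoint (N : ℕ) (β : ℝ) (s : ℕ → ℤ) : ℝ := val β s / radius N β

theorem Admissible.radius_pos {N : ℕ} {β : ℝ} (h : Admissible N β) : 0 < radius N β := by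
  have := h.two_le_cast
  have := h.lt_one
  exact div_pos (by linarith) (by linarith)

theorem isCode_iff {N : ℕ} {β : ℝ} (h : Admissible N β) {s : ℕ → ℤ} {t : ℝ} :
    IsCode N β s t ↔ BddBy (N - 1) s ∧ codePoint N β s = t := by
  have hd : (∀ l, s l ∈ digitSet N) ↔ BddBy (N - 1) s := by
    simp only [digitSet, Set.mem_Icc, BddBy, abs_le]
  rw [IsCode, hd]
  refine and_congr_right fun hs => ?_
  have h1 : 1 - β ≠ 0 := by linarith [h.lt_one]
  have h2 : (N : ℝ) - 1 ≠ 0 := by linarith [h.two_le_cast]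
  have hsum := (hs.hasSum h.pos h.lt_one).div_const (radius N β)
  have he : (fun l => (s l : ℝ) * β ^ l * (1 - β) / ((N : ℝ) - 1)) =
      fun l => (s l : ℝ) * β ^ l / radius N β := by
    funext l
    rw [radius]
    field_simp
  rw [he]
  exact ⟨fun ht => hsum.unique ht, fun ht => ht ▸ hsum⟩

theorem uniqueCodeSet_eq_image {N : ℕ} {β : ℝ} (h : Admissible N β) :
    uniqueCodeSet N β = codePoint N β '' {s | Univoque N β s} := by
  have hR := h.radius_pos
  ext t
  simp only [uniqueCodeSet, isCode_iff h, Set.mem_ofPred_eq, Set.mem_image]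
  constructor
  · rintro ⟨-, s, ⟨hs, rfl⟩, hu⟩
    refine ⟨s, univoque_of_unique h hs fun r hr hv => hu r ⟨hr, ?_⟩, rfl⟩
    rw [codePoint, hv, codePoint]
  · rintro ⟨s, hs, rfl⟩
    refine ⟨?_, s, ⟨hs.bdd, rfl⟩, fun r hr => ?_⟩
    · rw [Set.mem_Icc, ← abs_le, codePoint, abs_div, abs_of_pos hR, div_le_one hR]
      exact h.abs_val_le hs.bdd
    · refine (hs.eq_of_val_eq h hr.1 ?_).symm
      have := hr.2
      rw [codePoint, codePoint, div_left_inj' hR.ne'] at this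
      exact this.symm

theorem codePoint_injOn {N : ℕ} {β : ℝ} (h : Admissible N β) :
    Set.InjOn (codePoint N β) {s | Univoque N β s} := by
  intro s hs r hr he
  rw [codePoint, codePoint, div_left_inj' h.radius_pos.ne'] at he
  exact Univoque.eq_of_val_eq h hs (Univoque.bdd hr) he

/-! ### Values of binary sequences -/

/-- The value `∑ x_i β ^ i`, `i ≥ 0`, of a binary sequence. -/
noncomputable def bval (β : ℝ) (x : ℕ → Bool) : ℝ := val β fun i => (x i).toInt

/-- The difference sequence `x_{i+1} - x_i` of a binary sequence. -/
def diff (x : ℕ → Bool) : ℕ → ℤ := fun i => (x (i + 1)).toInt - (x i).toInt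

/-- The tail of `x` that starts at place `n`, complemented if necessary so that it starts with
`false`. -/
def normTail (x : ℕ → Bool) (n : ℕ) : ℕ → Bool := fun i => xor (x (i + n)) (x n)

theorem Bool.abs_toInt_le (b : Bool) : |b.toInt| ≤ 1 := by cases b <;> simp

theorem bddBy_toInt (x : ℕ → Bool) : BddBy 1 fun i => (x i).toInt :=
  fun i => Bool.abs_toInt_le (x i)

theorem bddBy_diff (x : ℕ → Bool) : BddBy 1 (diff x) := by
  intro i
  rw [diff]
  cases x (i + 1) <;> cases x i <;> simp

theorem shift_diff (x : ℕ → Bool) (n : ℕ) : shift n (diff x) = diff (shift n x) := by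
  funext i
  simp [shift, diff, add_right_comm]

theorem bval_nonneg {β : ℝ} (h0 : 0 < β) (x : ℕ → Bool) : 0 ≤ bval β x := by
  refine tsum_nonneg fun i => mul_nonneg ?_ (by positivity)
  dsimp only
  cases x i <;> simp

section Values

variable {β : ℝ} (h0 : 0 < β) (h1 : β < 1)
include h0 h1

theorem bval_compl (x : ℕ → Bool) : bval β (fun i => !x i) = 1 / (1 - β) - bval β x := by
  have h2 := (hasSum_geometric_of_lt_one h0.le h1).sub ((bddBy_toInt x).hasSum h0 h1)
  rw [one_div]
  refine HasSum.tsum_eq ?_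
  have e : (fun i => (((!x i).toInt : ℤ) : ℝ) * β ^ i) =
      fun i => β ^ i - ((x i).toInt : ℝ) * β ^ i := by
    funext i
    cases x i <;> simp
  rw [e]
  exact h2

theorem bval_le (x : ℕ → Bool) : bval β x ≤ 1 / (1 - β) := by
  have := bval_nonneg h0 fun i => !x i
  rw [bval_compl h0 h1] at this
  linarith

theorem bval_split (x : ℕ → Bool) (n : ℕ) : bval β (shift n x) =
    ((x n).toInt : ℝ) + β * bval β (shift (n + 1) x) :=
  (bddBy_toInt x).val_shift h0 h1 n

theorem mul_val_diff (x : ℕ → Bool) :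
    β * val β (diff x) = (1 - β) * bval β x - (x 0).toInt := by
  have h2 : val β (diff x) = bval β (shift 1 x) - bval β x := by
    refine HasSum.tsum_eq ?_
    have e : (fun i => (diff x i : ℝ) * β ^ i) =
        fun i => ((shift 1 x i).toInt : ℝ) * β ^ i - ((x i).toInt : ℝ) * β ^ i := by
      funext i
      simp only [diff, shift]
      push_cast
      ring
    rw [e]
    exact ((bddBy_toInt (shift 1 x)).hasSum h0 h1).sub ((bddBy_toInt x).hasSum h0 h1)
  have h3 := bval_split h0 h1 x 0
  rw [shift_zero, zero_add] at h3
  rw [h2]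
  linarith

/-- Summation by parts: up to sign, the value of a tail of a difference sequence is a positive
multiple of the value of the normalized tail of the binary sequence. -/
theorem mul_val_shift_diff (x : ℕ → Bool) (n : ℕ) : β * val β (shift n (diff x)) =
    (if x n then -1 else 1) * ((1 - β) * bval β (normTail x n)) := by
  rw [shift_diff, mul_val_diff h0 h1]
  cases hx : x n
  · have : normTail x n = shift n x := by
      funext i
      simp [normTail, hx, shift]
    simp [this, shift, hx]
  · have : normTail x n = fun i => !shift n x i := by
      funext i
      simp [normTail, hx, shift]
    rw [this, bval_compl h0 h1]
    have : 1 - β ≠ 0 := by linarith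
    simp [shift, hx]
    field_simp
    ring

theorem mul_abs_val_shift_diff (x : ℕ → Bool) (n : ℕ) :
    β * |val β (shift n (diff x))| = (1 - β) * bval β (normTail x n) := by
  have h2 : 0 ≤ (1 - β) * bval β (normTail x n) :=
    mul_nonneg (by linarith) (bval_nonneg h0 _)
  rw [← abs_of_pos h0, ← abs_mul, abs_of_pos h0, mul_val_shift_diff h0 h1, abs_mul,
    abs_of_nonneg h2]
  split_ifs <;> simp

theorem abs_val_shift_diff_le_one (x : ℕ → Bool) (n : ℕ) : |val β (shift n (diff x))| ≤ 1 := by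
  have h2 := mul_abs_val_shift_diff h0 h1 x n
  have h3 := bval_split h0 h1 (normTail x n) 0
  have h4 := bval_le h0 h1 (shift (0 + 1) (normTail x n))
  rw [le_div_iff₀ (by linarith)] at h4
  have h5 : normTail x n 0 = false := by simp [normTail]
  rw [h5, shift_zero] at h3
  rw [h3] at h2
  refine le_of_mul_le_mul_left ?_ h0
  rw [h2]
  simp only [Bool.toInt_false, Int.cast_zero]
  nlinarith

/-- For `β < 1 / 2` the lexicographic order of binary sequences is the order of their values; the
bound measures by how much the values differ. -/
theorem le_bval_sub_bval {x y : ℕ → Bool} {n : ℕ} (h : ∀ k < n, x k = y k) (hx : x n = false)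
    (hy : y n = true) : β ^ n * ((1 - 2 * β) / (1 - β)) ≤ bval β y - bval β x := by
  have h2 : bval β y - bval β x = β ^ n * (bval β (shift n y) - bval β (shift n x)) :=
    val_sub_val_of_agree (bddBy_toInt y) (bddBy_toInt x) h0 h1 fun k hk => by rw [h k hk]
  have h3 := bval_le h0 h1 (shift (n + 1) x)
  have h4 := bval_nonneg h0 (shift (n + 1) y)
  have h5 : (1 - 2 * β) / (1 - β) = 1 - β * (1 / (1 - β)) := by
    have : 1 - β ≠ 0 := by linarith
    field_simp
    ring
  rw [h2, bval_split h0 h1 y n, bval_split h0 h1 x n, hx, hy, h5]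
  refine mul_le_mul_of_nonneg_left ?_ (by positivity)
  simp only [Bool.toInt_true, Bool.toInt_false, Int.cast_zero, Int.cast_one]
  nlinarith

end Values

/-! ### Lexicographic comparison with the Thue–Morse sequence -/

/-- `x` is lexicographically at most `y` as far as the first `l` terms are concerned. -/
def LexLe (l : ℕ) (x y : ℕ → Bool) : Prop := ∀ i < l, (∀ k < i, x k = y k) → x i ≤ y i

theorem LexLe.bval_le {l : ℕ} {x y : ℕ → Bool} (h : LexLe l x y) {β : ℝ} (h0 : 0 < β)
    (h1 : β < 1 / 2) : bval β x ≤ bval β y + β ^ l / (1 - β) := by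
  have h2 : β < 1 := by linarith
  have h3 : 0 ≤ β ^ l / (1 - β) := div_nonneg (by positivity) (by linarith)
  by_cases hag : ∀ k < l, x k = y k
  · have e : bval β x - bval β y = β ^ l * (bval β (shift l x) - bval β (shift l y)) :=
      val_sub_val_of_agree (bddBy_toInt x) (bddBy_toInt y) h0 h2 fun k hk => by rw [hag k hk]
    have h4 : bval β (shift l x) - bval β (shift l y) ≤ 1 / (1 - β) := by
      linarith [_root_.bval_le h0 h2 (shift l x), bval_nonneg h0 (shift l y)]
    have := mul_le_mul_of_nonneg_left h4 (pow_pos h0 l).le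
    rw [mul_one_div] at this
    linarith
  · obtain ⟨n, hn, hne⟩ := exists_first_ne (fun he : x = y => hag fun k _ => congrFun he k)
    have hnl : n < l := by
      by_contra! hle
      exact hag fun k hk => hn k (by omega)
    have h5 := h n hnl hn
    have hxy : x n = false ∧ y n = true := by
      revert h5 hne
      cases x n <;> cases y n <;> simp
    have h6 := le_bval_sub_bval h0 h2 hn hxy.1 hxy.2
    have : 0 ≤ β ^ n * ((1 - 2 * β) / (1 - β)) :=
      mul_nonneg (by positivity) (div_nonneg (by linarith) (by linarith))
    linarith

theorem bval_lt_of_lexLe {x y : ℕ → Bool} (h : ∀ l, LexLe l x y) (hne : x ≠ y) {β : ℝ}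
    (h0 : 0 < β) (h1 : β < 1 / 2) : bval β x < bval β y := by
  have h2 : β < 1 := by linarith
  obtain ⟨n, hn, hne⟩ := exists_first_ne hne
  have h5 := h (n + 1) n (by omega) hn
  have hxy : x n = false ∧ y n = true := by
    revert h5 hne
    cases x n <;> cases y n <;> simp
  have h6 := le_bval_sub_bval h0 h2 hn hxy.1 hxy.2
  have : 0 < β ^ n * ((1 - 2 * β) / (1 - β)) :=
    mul_pos (by positivity) (div_pos (by linarith) (by linarith))
  linarith

/-- The substitution `0 ↦ 01`, `1 ↦ 10`. -/
def subst (x : ℕ → Bool) : ℕ → Bool := fun n => xor (x (n / 2)) (decide (n % 2 = 1))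

/-- The Thue–Morse sequence: the parity of the binary digit sum. -/
def thueMorse : ℕ → Bool
  | 0 => false
  | n + 1 => xor (thueMorse ((n + 1) / 2)) (decide ((n + 1) % 2 = 1))
  termination_by n => n
  decreasing_by omega

theorem thueMorse_zero : thueMorse 0 = false := by rw [thueMorse]

theorem subst_thueMorse : subst thueMorse = thueMorse := by
  funext n
  cases n with
  | zero => simp [subst, thueMorse_zero]
  | succ n =>
    conv_rhs => rw [thueMorse]
    rfl

theorem thueMorse_eq (n : ℕ) :
    thueMorse n = xor (thueMorse (n / 2)) (decide (n % 2 = 1)) :=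
  (congrFun subst_thueMorse n).symm

theorem thueMorse_one : thueMorse 1 = true := by
  rw [thueMorse_eq]
  simp [thueMorse_zero]

theorem thueMorse_two : thueMorse 2 = true := by
  rw [thueMorse_eq]
  simp [thueMorse_one]

theorem thueMorse_two_pow_add (n l : ℕ) (h : l < 2 ^ n) :
    thueMorse (2 ^ n + l) = !thueMorse l := by
  induction n generalizing l with
  | zero =>
    obtain rfl : l = 0 := by simpa using h
    simp [thueMorse_zero, thueMorse_one]
  | succ n ih =>
    have e1 : (2 ^ (n + 1) + l) / 2 = 2 ^ n + l / 2 := by omega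
    have e2 : (2 ^ (n + 1) + l) % 2 = l % 2 := by omega
    rw [thueMorse_eq, e1, e2, ih _ (by omega), thueMorse_eq l, Bool.not_xor]

/-- Every tail of `x`, complemented if it starts with `true`, is lexicographically at most the
Thue–Morse sequence as far as the first `l` terms are concerned. -/
def TailsLe (l : ℕ) (x : ℕ → Bool) : Prop := ∀ n, LexLe l (normTail x n) thueMorse

/-- The Thue–Morse sequence starts with `011`, and a normalized tail starts with `0`. -/
theorem tailsLe_three (x : ℕ → Bool) : TailsLe 3 x := by
  intro n i hi _
  interval_cases i
  · simp [normTail]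
  · simp [thueMorse_one, Bool.le_true]
  · simp [thueMorse_two, Bool.le_true]

/-- Tails of `subst x` that start at an odd place begin with `00` or `010` up to complement, hence
lie below the Thue–Morse sequence `011…`; the other ones are images of tails of `x`. -/
theorem TailsLe.subst {l : ℕ} {x : ℕ → Bool} (h : TailsLe l x) : TailsLe (2 * l) (subst x) := by
  intro n i hi hag
  have key : ∀ k, normTail (_root_.subst x) n k =
      xor (xor (x ((k + n) / 2)) (decide ((k + n) % 2 = 1)))
        (xor (x (n / 2)) (decide (n % 2 = 1))) := fun _ => rfl
  rcases Nat.even_or_odd' n with ⟨m, rfl | rfl⟩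
  · have key' : ∀ k, normTail (_root_.subst x) (2 * m) k =
        xor (normTail x m (k / 2)) (decide (k % 2 = 1)) := by
      intro k
      have e1 : (k + 2 * m) / 2 = k / 2 + m := by omega
      have e2 : (k + 2 * m) % 2 = k % 2 := by omega
      have e3 : (2 * m) / 2 = m := by omega
      rw [key, e1, e2, e3, normTail]
      simp
      generalize x (k / 2 + m) = a
      generalize x m = b
      generalize decide (k % 2 = 1) = c
      revert a b c
      decide
    have hag' : ∀ k < i, normTail x m (k / 2) = thueMorse (k / 2) := by
      intro k hk
      have := hag k hk
      rw [key', thueMorse_eq k] at this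
      simpa using this
    rw [key', thueMorse_eq i]
    rcases Nat.even_or_odd' i with ⟨j, rfl | rfl⟩
    · have h2 := h m j (by omega) fun k hk => by
        have := hag' (2 * k) (by omega)
        rwa [show 2 * k / 2 = k by omega] at this
      simpa using h2
    · rw [show (2 * j + 1) / 2 = j by omega]
      have := hag' (2 * j) (by omega)
      rw [show 2 * j / 2 = j by omega] at this
      rw [this]
  · by_cases hi3 : i < 3
    · interval_cases i
      · simp [normTail]
      · simp [thueMorse_one, Bool.le_true]
      · simp [thueMorse_two, Bool.le_true]
    · exfalso
      have a1 := hag 1 (by omega)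
      have a2 := hag 2 (by omega)
      rw [key, thueMorse_one, show (1 + (2 * m + 1)) / 2 = m + 1 by omega,
        show (2 * m + 1) / 2 = m by omega, show (1 + (2 * m + 1)) % 2 = 0 by omega,
        show (2 * m + 1) % 2 = 1 by omega] at a1
      rw [key, thueMorse_two, show (2 + (2 * m + 1)) / 2 = m + 1 by omega,
        show (2 * m + 1) / 2 = m by omega, show (2 + (2 * m + 1)) % 2 = 1 by omega,
        show (2 * m + 1) % 2 = 1 by omega] at a2
      revert a1 a2
      cases x (m + 1) <;> cases x m <;> simp

theorem tailsLe_iterate_subst (x : ℕ → Bool) (m : ℕ) : TailsLe (3 * 2 ^ m) (subst^[m] x) := by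
  induction m with
  | zero => exact tailsLe_three x
  | succ m ih =>
    rw [Function.iterate_succ_apply', pow_succ, ← mul_assoc, mul_comm _ 2]
    exact ih.subst

/-- The sequence `x` preceded by a copy of its first term. -/
def dup (x : ℕ → Bool) : ℕ → Bool := fun n => x (n - 1)

theorem TailsLe.dup {l : ℕ} {x : ℕ → Bool} (h : TailsLe l x) : TailsLe l (dup x) := by
  intro n i hi hag
  cases n with
  | zero =>
    rcases Nat.lt_or_ge i 2 with hi2 | hi2
    · interval_cases i
      · simp [normTail]
      · simp [thueMorse_one, Bool.le_true]
    · have := hag 1 (by omega)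
      simp [normTail, _root_.dup, thueMorse_one] at this
  | succ n =>
    have e : normTail (_root_.dup x) (n + 1) = normTail x n := by
      funext k
      simp [normTail, _root_.dup, ← add_assoc]
    rw [e] at hag ⊢
    exact h n i hi hag

/-! ### The centred sequence `λ` -/

/-- The sequence `λ_{i+1} - (N - 1)`, `i ≥ 0`, with values in `{-1, 0, 1}`. -/
def mu (N : ℕ) (i : ℕ) : ℤ := lam N (i + 1) - ((N : ℤ) - 1)

theorem mu_zero (N : ℕ) : mu N 0 = 1 := by
  simp [mu, lam_one]

theorem mu_two_pow_add (N n i : ℕ) (h : i + 1 < 2 ^ n) : mu N (2 ^ n + i) = -mu N i := by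
  have := lam_two_pow_add N n (i + 1) (by omega) h
  rw [mu, mu, add_assoc, this]
  ring

theorem mu_two_pow_add_last (N n i : ℕ) (h : i + 1 = 2 ^ n) :
    mu N (2 ^ n + i) = 1 - mu N i := by
  have h2 := lam_two_pow_succ N n
  have e : 2 ^ n + i + 1 = 2 ^ (n + 1) := by rw [pow_succ]; omega
  rw [mu, mu, e, h, h2]
  ring

theorem mu_eq_diff_two_pow (N n i : ℕ) (h : i + 1 = 2 ^ n) : mu N i = diff thueMorse i := by
  induction n generalizing i with
  | zero =>
    obtain rfl : i = 0 := by simpa using h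
    simp [mu_zero, diff, thueMorse_one, thueMorse_zero]
  | succ n ih =>
    obtain ⟨j, hj⟩ : ∃ j, j + 1 = 2 ^ n :=
      ⟨2 ^ n - 1, Nat.sub_add_cancel Nat.one_le_two_pow⟩
    have e : i = 2 ^ n + j := by rw [pow_succ] at h; omega
    have e2 : 2 ^ n + j + 1 = 2 ^ (n + 1) := by omega
    have t1 : ∀ m, thueMorse (2 ^ m) = true := fun m => by
      simpa [thueMorse_zero] using thueMorse_two_pow_add m 0 (by positivity)
    have := ih j hj
    rw [e, mu_two_pow_add_last N n j hj, this, diff, diff, e2, hj, t1, t1,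
      thueMorse_two_pow_add n j (by omega)]
    cases thueMorse j <;> simp

/-- The sequence `λ - (N - 1)` does not depend on `N`. -/
theorem mu_eq_diff (N : ℕ) : mu N = diff thueMorse := by
  funext i
  induction i using Nat.strong_induction_on with
  | _ i ih =>
    obtain ⟨n, h1, h2⟩ : ∃ n, 2 ^ n ≤ i + 1 ∧ i + 1 < 2 ^ (n + 1) :=
      ⟨Nat.log 2 (i + 1), Nat.pow_log_le_self 2 (by omega),
        Nat.lt_pow_succ_log_self (by norm_num) _⟩
    rcases h1.eq_or_lt with h3 | h3
    · exact mu_eq_diff_two_pow N n i h3.symm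
    · obtain ⟨j, rfl⟩ : ∃ j, i = 2 ^ n + j := ⟨i - 2 ^ n, by omega⟩
      have : 0 < 2 ^ n := by positivity
      rw [pow_succ] at h2
      rw [mu_two_pow_add N n j (by omega), ih j (by omega), diff, diff, add_assoc,
        thueMorse_two_pow_add n _ (by omega), thueMorse_two_pow_add n _ (by omega)]
      cases thueMorse j <;> cases thueMorse (j + 1) <;> simp

theorem bddBy_mu (N : ℕ) : BddBy 1 (mu N) := mu_eq_diff N ▸ bddBy_diff _

theorem mul_val_mu (N : ℕ) {β : ℝ} (h0 : 0 < β) (h1 : β < 1) :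
    β * val β (mu N) = (1 - β) * bval β thueMorse := by
  rw [mu_eq_diff, mul_val_diff h0 h1, thueMorse_zero]
  simp

/-! ### The critical parameter -/

theorem lam_succ_eq (N : ℕ) (i : ℕ) : lam N (i + 1) = N - 1 + mu N i := by
  rw [mu]
  ring

theorem hasSum_lam {N : ℕ} {β : ℝ} (h : Admissible N β) :
    HasSum (fun l : ℕ => (lam N (l + 1) : ℝ) * β ^ (l + 1))
      (β * (radius N β + val β (mu N))) := by
  have h2 := (((hasSum_geometric_of_lt_one h.pos.le h.lt_one).mul_left ((N : ℝ) - 1)).add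
    ((bddBy_mu N).hasSum h.pos h.lt_one)).mul_left β
  rw [radius, div_eq_mul_inv]
  have e : (fun l : ℕ => (lam N (l + 1) : ℝ) * β ^ (l + 1)) =
      fun l => β * (((N : ℝ) - 1) * β ^ l + (mu N l : ℝ) * β ^ l) := by
    funext l
    rw [lam_succ_eq]
    push_cast
    ring
  rw [e]
  exact h2

theorem hasSum_lam_lt {N : ℕ} (hN : 2 ≤ N) {a b s t : ℝ} (ha : 0 < a) (hab : a < b)
    (hs : HasSum (fun l : ℕ => (lam N (l + 1) : ℝ) * a ^ (l + 1)) s)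
    (ht : HasSum (fun l : ℕ => (lam N (l + 1) : ℝ) * b ^ (l + 1)) t) : s < t := by
  have hnn : ∀ l, (0 : ℝ) ≤ lam N (l + 1) := fun l => by
    have := (abs_le.1 (bddBy_mu N l)).1
    have h2 := lam_succ_eq N l
    have : 0 ≤ lam N (l + 1) := by omega
    exact_mod_cast this
  refine hasSum_lt (i := 0) (fun l => ?_) ?_ hs ht
  · have := hnn l
    gcongr
  · have : (2 : ℝ) ≤ N := by exact_mod_cast hN
    simp only [zero_add, lam_one, Int.cast_natCast, pow_one]
    nlinarith

theorem hasSum_lam_sub_one {N : ℕ} {β : ℝ} (h : Admissible N β) :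
    β * (radius N β + val β (mu N)) - 1 = β * (val β (mu N) - threshold N β) := by
  have := h.mul_threshold
  linarith

theorem exists_critical (N : ℕ) (hN : 2 ≤ N) : ∃ b, Admissible N b ∧
    HasSum (fun l : ℕ => (lam N (l + 1) : ℝ) * b ^ (l + 1)) 1 := by
  have hN' : (2 : ℝ) ≤ N := by exact_mod_cast hN
  set F : ℝ → ℝ := fun b => ∑' l : ℕ, (lam N (l + 1) : ℝ) * b ^ (l + 1) with hF
  set a₀ : ℝ := 1 / (2 * (N : ℝ) - 1) with ha₀
  set a₁ : ℝ := 1 / (N : ℝ) with ha₁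
  have h0 : 0 < a₀ := div_pos one_pos (by linarith)
  have h01 : a₀ < a₁ := one_div_lt_one_div_of_lt (by linarith) (by linarith)
  have h1 : a₁ ≤ 1 / 2 := one_div_le_one_div_of_le (by norm_num) hN'
  have hlam : ∀ l, |(lam N (l + 1) : ℝ)| ≤ N := fun l => by
    have := abs_le.1 (bddBy_mu N l)
    have h2 := lam_succ_eq N l
    have : |lam N (l + 1)| ≤ N := abs_le.2 ⟨by omega, by omega⟩
    exact_mod_cast this
  have hsummable : ∀ b : ℝ, 0 < b → b < 1 →
      Summable fun l : ℕ => (lam N (l + 1) : ℝ) * b ^ (l + 1) := by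
    intro b hb0 hb1
    have hb : BddBy N fun l => lam N (l + 1) := fun l => by exact_mod_cast hlam l
    simpa [pow_succ, mul_assoc] using (hb.summable hb0 hb1).mul_right b
  have hcont : ContinuousOn F (Set.Icc a₀ a₁) := by
    refine continuousOn_tsum (u := fun l => N * (1 / 2 : ℝ) ^ (l + 1)) (fun l => by fun_prop) ?_ ?_
    · exact ((summable_nat_add_iff 1).2 summable_geometric_two).mul_left _
    · intro l x hx
      have hx0 : 0 ≤ x := h0.le.trans hx.1
      rw [norm_mul, norm_pow, Real.norm_eq_abs, Real.norm_eq_abs, abs_of_nonneg hx0]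
      have := hlam l
      have := hx.2
      gcongr
      linarith
  -- at the left end, compare with the constant sequence `2 N - 2`
  have hlo : F a₀ < 1 := by
    have hg := ((hasSum_geometric_of_lt_one h0.le (by linarith : a₀ < 1)).mul_left
      ((2 * (N : ℝ) - 2) * a₀))
    have e : (2 * (N : ℝ) - 2) * a₀ * (1 - a₀)⁻¹ = 1 := by
      have : 2 * (N : ℝ) - 1 ≠ 0 := by linarith
      have : 2 * (N : ℝ) - 1 - 1 ≠ 0 := by linarith
      rw [ha₀]
      field_simp
      ring
    rw [e] at hg
    refine hasSum_lt (i := 1) (fun l => ?_) ?_ (hsummable a₀ h0 (by linarith)).hasSum hg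
    · have h2 := lam_succ_eq N l
      have h3 := (abs_le.1 (bddBy_mu N l)).2
      have h4 : lam N (l + 1) ≤ 2 * N - 2 := by omega
      have h5 : (lam N (l + 1) : ℝ) ≤ 2 * N - 2 := by exact_mod_cast h4
      calc (lam N (l + 1) : ℝ) * a₀ ^ (l + 1) ≤ (2 * N - 2) * a₀ ^ (l + 1) := by gcongr
        _ = _ := by ring
    · have h2 := lam_two_pow_succ N 0
      simp only [zero_add, pow_one, pow_zero, lam_one] at h2
      have h3 : (lam N (1 + 1) : ℝ) = N - 1 := by
        have : lam N 2 = N - 1 := by rw [h2]; ring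
        rw [show 1 + 1 = 2 from rfl, this]
        push_cast
        ring
      rw [h3]
      have : 0 < ((N : ℝ) - 1) * (a₀ * a₀) := mul_pos (by linarith) (by positivity)
      calc ((N : ℝ) - 1) * a₀ ^ (1 + 1) = (N - 1) * (a₀ * a₀) := by ring
        _ < 2 * ((N - 1) * (a₀ * a₀)) := by linarith
        _ = _ := by ring
  -- at the right end, the first term alone is `1`
  have hhi : 1 < F a₁ := by
    have hs := (hsummable a₁ (h0.trans h01) (by linarith)).hasSum
    have h2 := lam_two_pow_succ N 0
    simp only [zero_add, pow_one, pow_zero, lam_one] at h2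
    have hz : HasSum (fun l : ℕ => if l = 0 then (1 : ℝ) else 0) 1 := by
      simpa using hasSum_ite_eq (0 : ℕ) (1 : ℝ)
    have ha1 : 0 < a₁ := h0.trans h01
    refine hasSum_lt (i := 1) (fun l => ?_) ?_ hz hs
    · dsimp only
      split_ifs with hl
      · subst hl
        simp only [zero_add, lam_one, pow_one, ha₁, Int.cast_natCast]
        rw [mul_one_div_cancel (by linarith)]
      · have := (abs_le.1 (bddBy_mu N l)).1
        have h2 := lam_succ_eq N l
        have : 0 ≤ lam N (l + 1) := by omega
        have : (0 : ℝ) ≤ lam N (l + 1) := by exact_mod_cast this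
        positivity
    · have h3 : (0 : ℝ) < lam N (1 + 1) := by
        have : 0 < lam N (1 + 1) := by rw [show 1 + 1 = 2 from rfl, h2]; omega
        exact_mod_cast this
      simp only [one_ne_zero, if_false]
      positivity
  obtain ⟨b, hb, hFb⟩ := intermediate_value_Icc h01.le hcont ⟨hlo.le, hhi.le⟩
  have hb0 : a₀ ≠ b := by rintro rfl; exact hlo.ne hFb
  have hb1 : b ≠ a₁ := by rintro rfl; exact hhi.ne' hFb
  refine ⟨b, ⟨hN, lt_of_le_of_ne hb.1 hb0, lt_of_le_of_ne hb.2 hb1⟩, ?_⟩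
  have := (hsummable b (h0.trans_le hb.1) (by linarith [hb.2])).hasSum
  rwa [show ∑' l : ℕ, (lam N (l + 1) : ℝ) * b ^ (l + 1) = 1 from hFb] at this

theorem lt_threshold_of_lt_critical {N : ℕ} {β b : ℝ} (h : Admissible N β)
    (hb : HasSum (fun l : ℕ => (lam N (l + 1) : ℝ) * b ^ (l + 1)) 1) (hlt : β < b) :
    val β (mu N) < threshold N β := by
  have h1 := hasSum_lam_lt h.two_le h.pos hlt (hasSum_lam h) hb
  have h2 := hasSum_lam_sub_one h
  have : β * (val β (mu N) - threshold N β) < 0 := by linarith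
  have := neg_of_mul_neg_right this h.pos.le
  linarith

theorem threshold_eq_of_critical {N : ℕ} {β : ℝ} (h : Admissible N β)
    (hb : HasSum (fun l : ℕ => (lam N (l + 1) : ℝ) * β ^ (l + 1)) 1) :
    threshold N β = val β (mu N) := by
  have h1 := (hasSum_lam h).unique hb
  have h2 := hasSum_lam_sub_one h
  rw [h1, sub_self, eq_comm, mul_eq_zero, or_iff_right h.pos.ne'] at h2
  linarith

theorem threshold_lt_of_critical_lt {N : ℕ} {β b : ℝ} (h : Admissible N β) (hb0 : 0 < b)
    (hb : HasSum (fun l : ℕ => (lam N (l + 1) : ℝ) * b ^ (l + 1)) 1) (hlt : b < β) :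
    threshold N β < val β (mu N) := by
  have h1 := hasSum_lam_lt h.two_le hb0 hlt hb (hasSum_lam h)
  have h2 := hasSum_lam_sub_one h
  have : 0 < β * (val β (mu N) - threshold N β) := by linarith
  have := pos_of_mul_pos_right this h.pos.le
  linarith

/-! ### Sequences between `-μ` and `μ` -/

/-- Every tail of `s` is lexicographically at most `μ`, and so is every tail of `-s`. -/
def LexBounded (N : ℕ) (s : ℕ → ℤ) : Prop :=
  ∀ (e : ℤˣ) (k i : ℕ), (∀ l < i, s (l + k) = e * mu N l) → e * s (i + k) ≤ mu N i

/-- The block `μ_1 … μ_{2^n}`, multiplied by the sign `e`, occurs in `s` at place `k`. -/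
def Occurs (N n k : ℕ) (e : ℤˣ) (s : ℕ → ℤ) : Prop := ∀ i < 2 ^ n, s (i + k) = e * mu N i

theorem Trapped.lexLe_mu {N : ℕ} {β : ℝ} (h : Admissible N β) {s : ℕ → ℤ} (hs : Trapped N β s)
    (hc : threshold N β ≤ val β (mu N)) {i : ℕ} (hi : ∀ l < i, s l = mu N l) : s i ≤ mu N i := by
  by_contra! hlt
  have h0 := h.pos
  have h1 := h.lt_one
  have h2 := h.mul_threshold_lt
  have e := val_sub_val_of_agree hs.bdd (bddBy_mu N) h0 h1 hi
  rw [hs.bdd.val_shift h0 h1, (bddBy_mu N).val_shift h0 h1] at e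
  have h3 : val β s < threshold N β := (abs_lt.1 (hs.abs_val_lt 0)).2
  have h4 := (abs_lt.1 (hs.abs_val_lt (i + 1))).1
  have h5 : val β (_root_.shift (i + 1) (mu N)) ≤ 1 := by
    rw [mu_eq_diff]
    exact (abs_le.1 (abs_val_shift_diff_le_one h0 h1 _ _)).2
  have h6 : (mu N i : ℝ) + 1 ≤ s i := by exact_mod_cast hlt
  have h7 := mul_lt_mul_of_pos_left h4 h0
  have h8 := mul_le_mul_of_nonneg_left h5 h0.le
  have h9 := h.lt_half
  have : 0 < β ^ i * (s i + β * val β (_root_.shift (i + 1) s) -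
      (mu N i + β * val β (_root_.shift (i + 1) (mu N)))) :=
    mul_pos (pow_pos h0 i) (by linarith)
  linarith

theorem Trapped.lexBounded {N : ℕ} {β : ℝ} (h : Admissible N β) {s : ℕ → ℤ} (hs : Trapped N β s)
    (hc : threshold N β ≤ val β (mu N)) : LexBounded N s := by
  intro e k i hi
  rcases Int.units_eq_one_or e with rfl | rfl
  · simpa [_root_.shift] using (hs.shift k).lexLe_mu h hc (i := i) fun l hl => by
      simpa [_root_.shift] using hi l hl
  · simpa [_root_.shift] using (hs.shift k).neg.lexLe_mu h hc (i := i) fun l hl => by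
      simp [_root_.shift, hi l hl]

theorem units_mul_self_cast (e : ℤˣ) : (e : ℤ) * e = 1 := by
  rcases Int.units_eq_one_or e with rfl | rfl <;> simp

/-- The lower and the upper lexicographic bound for the block behind an occurrence of
`μ_1 … μ_{2^n}` agree up to the last term, where they differ by one. -/
theorem LexBounded.bounds {N n k : ℕ} {e : ℤˣ} {s : ℕ → ℤ} (h : LexBounded N s)
    (ho : Occurs N n k e s) {i : ℕ} (hi : i < 2 ^ n)
    (hag : ∀ l < i, s (l + (k + 2 ^ n)) = -e * mu N l) :
    -(e * s (i + (k + 2 ^ n))) ≤ mu N i ∧ e * s (i + (k + 2 ^ n)) ≤ mu N (2 ^ n + i) := by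
  constructor
  · have := h (-e) (k + 2 ^ n) i fun l hl => by simpa using hag l hl
    simpa using this
  · have := h e k (2 ^ n + i) fun l hl => by
      rcases Nat.lt_or_ge l (2 ^ n) with hl2 | hl2
      · exact ho l hl2
      · obtain ⟨j, rfl⟩ := Nat.exists_eq_add_of_le hl2
        rw [mu_two_pow_add N n j (by omega), show 2 ^ n + j + k = j + (k + 2 ^ n) by omega,
          hag j (by omega)]
        ring
    rwa [show 2 ^ n + i + k = i + (k + 2 ^ n) by omega] at this

theorem LexBounded.next_eq {N n k : ℕ} {e : ℤˣ} {s : ℕ → ℤ} (h : LexBounded N s)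
    (ho : Occurs N n k e s) {i : ℕ} (hi : i + 1 < 2 ^ n) :
    s (i + (k + 2 ^ n)) = -e * mu N i := by
  induction i using Nat.strong_induction_on with
  | _ i ih =>
    obtain ⟨h1, h2⟩ := h.bounds ho (i := i) (by omega) fun l hl => ih l hl (by omega)
    rw [mu_two_pow_add N n i hi] at h2
    have h3 : e * s (i + (k + 2 ^ n)) = -mu N i := by omega
    have h4 := units_mul_self_cast e
    calc s (i + (k + 2 ^ n)) = e * e * s (i + (k + 2 ^ n)) := by rw [h4, one_mul]
      _ = _ := by rw [mul_assoc, h3]; ring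

theorem LexBounded.next_last {N n k : ℕ} {e : ℤˣ} {s : ℕ → ℤ} (h : LexBounded N s)
    (ho : Occurs N n k e s) {i : ℕ} (hi : i + 1 = 2 ^ n) :
    s (i + (k + 2 ^ n)) = -e * mu N i ∨ s (i + (k + 2 ^ n)) = -e * (mu N i - 1) := by
  obtain ⟨h1, h2⟩ := h.bounds ho (i := i) (by omega) fun l hl => h.next_eq ho (by omega)
  rw [mu_two_pow_add_last N n i hi] at h2
  have h4 := units_mul_self_cast e
  have h5 : s (i + (k + 2 ^ n)) = e * (e * s (i + (k + 2 ^ n))) := by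
    rw [← mul_assoc, h4, one_mul]
  have h3 : e * s (i + (k + 2 ^ n)) = -mu N i ∨ e * s (i + (k + 2 ^ n)) = 1 - mu N i := by omega
  rcases h3 with h3 | h3
  · left
    rw [h5, h3]
    ring
  · right
    rw [h5, h3]
    ring

theorem LexBounded.occurs_succ_or {N n k : ℕ} {e : ℤˣ} {s : ℕ → ℤ} (h : LexBounded N s)
    (ho : Occurs N n k e s) : Occurs N (n + 1) k e s ∨ Occurs N n (k + 2 ^ n) (-e) s := by
  obtain ⟨j, hj⟩ : ∃ j, j + 1 = 2 ^ n := ⟨2 ^ n - 1, Nat.sub_add_cancel Nat.one_le_two_pow⟩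
  rcases h.next_last ho hj with h1 | h1
  · right
    intro i hi
    rcases Nat.lt_or_ge (i + 1) (2 ^ n) with h2 | h2
    · simpa using h.next_eq ho h2
    · obtain rfl : i = j := by omega
      simpa using h1
  · left
    intro i hi
    rcases Nat.lt_or_ge i (2 ^ n) with h2 | h2
    · exact ho i h2
    · obtain ⟨l, rfl⟩ := Nat.exists_eq_add_of_le h2
      rw [pow_succ] at hi
      rw [show 2 ^ n + l + k = l + (k + 2 ^ n) by omega]
      rcases Nat.lt_or_ge (l + 1) (2 ^ n) with h3 | h3
      · rw [h.next_eq ho h3, mu_two_pow_add N n l h3]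
        ring
      · obtain rfl : l = j := by omega
        rw [h1, mu_two_pow_add_last N n l hj]
        ring

/-- The block `μ_1 … μ_{2^n}`, with its last term lowered by one if `a.2`, times the sign `a.1`. -/
def block (N n : ℕ) (a : ℤˣ × Bool) (i : ℕ) : ℤ :=
  a.1 * (mu N i - if a.2 = true ∧ i + 1 = 2 ^ n then 1 else 0)

theorem Occurs.eq_block {N n k : ℕ} {e : ℤˣ} {s : ℕ → ℤ} (ho : Occurs N n k e s) :
    ∃ a, ∀ i < 2 ^ n, s (i + k) = block N n a i :=
  ⟨(e, false), fun i hi => by simp [block, ho i hi]⟩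

theorem LexBounded.next_eq_block {N n k : ℕ} {e : ℤˣ} {s : ℕ → ℤ} (h : LexBounded N s)
    (ho : Occurs N n k e s) : ∃ a, ∀ i < 2 ^ n, s (i + (k + 2 ^ n)) = block N n a i := by
  obtain ⟨j, hj⟩ : ∃ j, j + 1 = 2 ^ n := ⟨2 ^ n - 1, Nat.sub_add_cancel Nat.one_le_two_pow⟩
  rcases h.next_last ho hj with h1 | h1
  · refine ⟨(-e, false), fun i hi => ?_⟩
    rcases Nat.lt_or_ge (i + 1) (2 ^ n) with h2 | h2
    · simpa [block] using h.next_eq ho h2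
    · obtain rfl : i = j := by omega
      simpa [block] using h1
  · refine ⟨(-e, true), fun i hi => ?_⟩
    rcases Nat.lt_or_ge (i + 1) (2 ^ n) with h2 | h2
    · simpa [block, h2.ne] using h.next_eq ho h2
    · obtain rfl : i = j := by omega
      simpa [block, hj] using h1

/-- Behind an occurrence of `±μ_1 … μ_{2^n}`, the sequence is a concatenation of blocks of length
`2 ^ n` of only four kinds. -/
theorem LexBounded.eq_block {N n k : ℕ} {e : ℤˣ} {s : ℕ → ℤ} (h : LexBounded N s)
    (ho : Occurs N n k e s) (m : ℕ) :
    ∃ a, ∀ i < 2 ^ n, s (i + m * 2 ^ n + k) = block N n a i := by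
  have key : ∀ m, (∃ e, Occurs N n (k + m * 2 ^ n) e s) ∨
      (∃ a, ∀ i < 2 ^ n, s (i + (k + m * 2 ^ n)) = block N n a i) ∧
        ∃ e, Occurs N n (k + (m + 1) * 2 ^ n) e s := by
    intro m
    induction m with
    | zero => exact Or.inl ⟨e, by simpa using ho⟩
    | succ m ih =>
      rcases ih with ⟨f, hf⟩ | ⟨-, hf⟩
      · have e1 : k + (m + 1) * 2 ^ n = k + m * 2 ^ n + 2 ^ n := by ring
        rcases h.occurs_succ_or hf with h1 | h1
        · right
          refine ⟨by rw [e1]; exact h.next_eq_block hf, -f, fun i hi => ?_⟩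
          have h2 := h.next_eq h1 (i := i) (by rw [pow_succ]; omega)
          rw [show k + (m + 1 + 1) * 2 ^ n = k + m * 2 ^ n + 2 ^ (n + 1) by ring]
          simpa using h2
        · exact Or.inl ⟨-f, by rwa [e1]⟩
      · exact Or.inl hf
  have e2 : ∀ i, i + m * 2 ^ n + k = i + (k + m * 2 ^ n) := fun i => by omega
  simp only [e2]
  rcases key m with ⟨f, hf⟩ | ⟨hb, -⟩
  · exact hf.eq_block
  · exact hb

/-- The zero sequence and the periodic sequences `±(w (-w))^∞` with `w = μ_1 … μ_{2^n}`. -/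
def periodicSeq (N : ℕ) : Option (ℕ × ℤˣ) → ℕ → ℤ
  | none => 0
  | some (n, e) => fun i => (((-1) ^ (i / 2 ^ n) * e : ℤˣ) : ℤ) * mu N (i % 2 ^ n)

/-- The sequences with a tail among `periodicSeq`. -/
def eventuallyPeriodic (N : ℕ) : Set (ℕ → ℤ) := {s | ∃ k, shift k s ∈ Set.range (periodicSeq N)}

theorem countable_setOf_shift_mem {α : Type*} [Countable α] {C : Set (ℕ → α)}
    (hC : C.Countable) : {s : ℕ → α | ∃ k, shift k s ∈ C}.Countable := by
  rw [show {s : ℕ → α | ∃ k, shift k s ∈ C} = ⋃ k, {s | shift k s ∈ C} by ext; simp]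
  refine Set.countable_iUnion fun k => ?_
  let f : (ℕ → α) → (Fin k → α) × (ℕ → α) := fun s => (fun i => s i, shift k s)
  have hf : Function.Injective f := by
    intro s r he
    simp only [f, Prod.mk.injEq] at he
    funext i
    rcases Nat.lt_or_ge i k with hi | hi
    · exact congrFun he.1 ⟨i, hi⟩
    · have := congrFun he.2 (i - k)
      simpa [shift, Nat.sub_add_cancel hi] using this
  refine Set.Countable.mono (fun s hs => ?_)
    (((Set.countable_univ (α := Fin k → α)).prod hC).preimage_of_injOn hf.injOn)
  exact ⟨trivial, hs⟩

theorem countable_eventuallyPeriodic (N : ℕ) : (eventuallyPeriodic N).Countable :=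
  countable_setOf_shift_mem (Set.countable_range _)

theorem LexBounded.occurs_or_mem {N : ℕ} {s : ℕ → ℤ} (h : LexBounded N s) (n : ℕ) :
    (∃ k e, Occurs N n k e s) ∨ s ∈ eventuallyPeriodic N := by
  induction n with
  | zero =>
    by_cases hz : s = 0
    · exact Or.inr ⟨0, none, hz.symm⟩
    · left
      obtain ⟨k, hk⟩ := Function.ne_iff.1 hz
      have h1 := h 1 k 0 (by simp)
      have h2 := h (-1) k 0 (by simp)
      simp only [Units.val_one, one_mul, zero_add, mu_zero, Units.val_neg, neg_mul] at h1 h2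
      have h3 : s k = 1 ∨ s k = -1 := by
        have : s k ≠ 0 := hk
        omega
      rcases h3 with h3 | h3
      · exact ⟨k, 1, fun i hi => by
          obtain rfl : i = 0 := by simpa using hi
          simp [h3, mu_zero]⟩
      · exact ⟨k, -1, fun i hi => by
          obtain rfl : i = 0 := by simpa using hi
          simp [h3, mu_zero]⟩
  | succ n ih =>
    rcases ih with ⟨k, e, ho⟩ | hs
    swap
    · exact Or.inr hs
    by_cases hex : ∃ k e, Occurs N (n + 1) k e s
    · exact Or.inl hex
    right
    have hall : ∀ r, Occurs N n (k + r * 2 ^ n) ((-1) ^ r * e) s := by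
      intro r
      induction r with
      | zero => simpa using ho
      | succ r ih =>
        rcases h.occurs_succ_or ih with h1 | h1
        · exact absurd ⟨_, _, h1⟩ hex
        · rw [show k + (r + 1) * 2 ^ n = k + r * 2 ^ n + 2 ^ n by ring]
          simpa [pow_succ] using h1
    refine ⟨k, some (n, e), ?_⟩
    funext i
    have h1 := hall (i / 2 ^ n) (i % 2 ^ n) (Nat.mod_lt _ (by positivity))
    rw [show i % 2 ^ n + (k + i / 2 ^ n * 2 ^ n) = i + k by
      have := Nat.mod_add_div' i (2 ^ n)
      omega] at h1
    exact h1.symm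

/-! ### Parameters above the critical one: countability -/

theorem Admissible.exists_not_occurs {N : ℕ} {β : ℝ} (h : Admissible N β)
    (hc : threshold N β < val β (mu N)) :
    ∃ n, ∀ s k e, Trapped N β s → ¬ Occurs N n k e s := by
  have h0 := h.pos
  have h1 := h.lt_one
  set K : ℝ := 1 / (1 - β) + threshold N β with hK
  have hKpos : 0 < K := add_pos (div_pos one_pos (by linarith)) h.threshold_pos
  obtain ⟨m, hm⟩ := exists_pow_lt_of_lt_one (div_pos (sub_pos.2 hc) hKpos) h1
  refine ⟨m, fun s k e hs ho => ?_⟩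
  obtain ⟨r, hr, hra⟩ : ∃ r, Trapped N β r ∧ ∀ i < 2 ^ m, mu N i = r i := by
    rcases Int.units_eq_one_or e with rfl | rfl
    · exact ⟨_, hs.shift k, fun i hi => by simpa [shift] using (ho i hi).symm⟩
    · exact ⟨_, (hs.shift k).neg, fun i hi => by simp [shift, ho i hi]⟩
  have e1 := val_sub_val_of_agree (bddBy_mu N) hr.bdd h0 h1 hra
  have h2 := (abs_le.1 (((bddBy_mu N).shift (2 ^ m)).abs_val_le h0 h1)).2
  have h3 := (abs_lt.1 (hr.abs_val_lt (2 ^ m))).1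
  have h4 := (abs_lt.1 (hr.abs_val_lt 0)).2
  rw [shift_zero] at h4
  push_cast at h2
  have h5 : val β (shift (2 ^ m) (mu N)) - val β (shift (2 ^ m) r) ≤ K := by linarith
  have h6 : β ^ 2 ^ m ≤ β ^ m := pow_le_pow_of_le_one h0.le h1.le Nat.lt_two_pow_self.le
  rw [lt_div_iff₀ hKpos] at hm
  have h7 := mul_le_mul_of_nonneg_left h5 (pow_pos h0 (2 ^ m)).le
  have h8 := mul_le_mul_of_nonneg_right h6 hKpos.le
  linarith

theorem univoque_subset {N : ℕ} {β : ℝ} (h : Admissible N β) :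
    {s | Univoque N β s} ⊆ {fun _ => (N : ℤ) - 1, fun _ => -((N : ℤ) - 1)} ∪
      {s | BddBy (N - 1) s ∧ ∃ k, Trapped N β (shift k s)} := by
  intro s hs
  rcases Univoque.eventually_trapped h hs with h1 | h1 | h1
  · exact Or.inl (Or.inl h1)
  · exact Or.inl (Or.inr h1)
  · exact Or.inr ⟨Univoque.bdd hs, h1⟩

theorem countable_uniqueCodeSet {N : ℕ} {β : ℝ} (h : Admissible N β)
    (hc : threshold N β < val β (mu N)) : (uniqueCodeSet N β).Countable := by
  obtain ⟨n, hn⟩ := h.exists_not_occurs hc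
  rw [uniqueCodeSet_eq_image h]
  refine Set.Countable.image (Set.Countable.mono (univoque_subset h) ?_) _
  refine Set.Countable.union (Set.toFinite _).countable ?_
  refine Set.Countable.mono ?_ (countable_setOf_shift_mem (countable_eventuallyPeriodic N))
  rintro s ⟨-, k, hk⟩
  refine ⟨k, ?_⟩
  rcases (hk.lexBounded h hc.le).occurs_or_mem n with ⟨l, e, ho⟩ | hmem
  · exact absurd ho (hn _ _ _ hk)
  · exact hmem

theorem infinite_uniqueCodeSet {N : ℕ} {β : ℝ} (h : Admissible N β) :
    (uniqueCodeSet N β).Infinite := by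
  have hN := h.two_le
  rw [uniqueCodeSet_eq_image h]
  -- the sequences `(N - 1) … (N - 1) 0 0 …` are univoque
  let f : ℕ → ℕ → ℤ := fun k i => if i < k then (N : ℤ) - 1 else 0
  have hb : ∀ k, BddBy (N - 1) (f k) := fun k i => by
    simp only [f]
    split_ifs <;> rw [abs_le] <;> omega
  have hf : ∀ k, Univoque N β (f k) := fun k =>
    { bdd := hb k
      lt := fun n hn => by
        have hkn : k ≤ n := by
          by_contra! hlt
          simp [f, hlt] at hn
        have hz : shift (n + 1) (f k) = 0 := by
          funext i
          simp only [f, shift]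
          rw [if_neg (by omega)]
          rfl
        rw [hz]
        simpa [val] using h.threshold_pos
      gt := fun n _ => by
        have : 0 ≤ val β (shift (n + 1) (f k)) := by
          refine tsum_nonneg fun i => mul_nonneg ?_ (pow_nonneg h.pos.le i)
          have : 0 ≤ shift (n + 1) (f k) i := by
            simp only [f, shift]
            split_ifs <;> omega
          exact_mod_cast this
        linarith [h.threshold_pos] }
  have hinj : Function.Injective f := by
    intro k l he
    rcases lt_trichotomy k l with hkl | hkl | hkl
    · have := congrFun he k
      simp only [f, lt_irrefl, if_false, if_pos hkl] at this
      omega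
    · exact hkl
    · have := congrFun he l
      simp only [f, lt_irrefl, if_false, if_pos hkl] at this
      omega
  exact (Set.infinite_of_injective_forall_mem hinj hf).image (codePoint_injOn h)

/-! ### The critical parameter: dimension zero -/

/-- The values of the sequences that are concatenations of the blocks `w a` of length `L`. The
cylinders of `m` blocks are covered by `(card ι) ^ m` sets of diameter `O(β ^ (L m))`. -/
theorem dimH_image_val_blocks_le {ι : Type*} [Fintype ι] (w : ι → ℕ → ℤ) {L : ℕ} (hL : 0 < L)
    {β : ℝ} (h0 : 0 < β) (h1 : β < 1) {C : ℤ} (hC : 0 ≤ C) {d : NNReal}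
    (hd : (Fintype.card ι : ℝ) * (β ^ L) ^ (d : ℝ) ≤ 1) :
    dimH (val β '' {s | BddBy C s ∧ ∀ m, ∃ a, ∀ i < L, s (i + m * L) = w a i}) ≤ d := by
  set S : Set (ℕ → ℤ) := {s | BddBy C s ∧ ∀ m, ∃ a, ∀ i < L, s (i + m * L) = w a i} with hS
  set D : ℝ := C / (1 - β) + C / (1 - β) with hD
  have hC' : (0 : ℝ) ≤ C := by exact_mod_cast hC
  have hD0 : 0 ≤ D := by
    have : 0 ≤ (C : ℝ) / (1 - β) := div_nonneg hC' (by linarith)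
    linarith
  let t : ∀ m : ℕ, (Fin m → ι) → Set ℝ := fun m a =>
    val β '' {s | BddBy C s ∧ ∀ r : Fin m, ∀ i < L, s (i + r * L) = w (a r) i}
  have hdiam : ∀ m a, Metric.ediam (t m a) ≤ ENNReal.ofReal (D * (β ^ L) ^ m) := by
    intro m a
    refine Metric.ediam_le ?_
    rintro _ ⟨s, ⟨hs, hsw⟩, rfl⟩ _ ⟨r, ⟨hr, hrw⟩, rfl⟩
    rw [edist_dist, Real.dist_eq]
    refine ENNReal.ofReal_le_ofReal ?_
    have hag : ∀ k < L * m, s k = r k := by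
      intro k hk
      have hq : k / L < m := Nat.div_lt_of_lt_mul hk
      have e := Nat.mod_add_div' k L
      have e1 := hsw ⟨k / L, hq⟩ (k % L) (Nat.mod_lt _ hL)
      have e2 := hrw ⟨k / L, hq⟩ (k % L) (Nat.mod_lt _ hL)
      simp only [e] at e1 e2
      rw [e1, e2]
    rw [val_sub_val_of_agree hs hr h0 h1 hag, abs_mul, abs_of_pos (pow_pos h0 _), pow_mul, mul_comm]
    refine mul_le_mul_of_nonneg_right ?_ (by positivity)
    have e1 := (hs.shift (L * m)).abs_val_le h0 h1
    have e2 := (hr.shift (L * m)).abs_val_le h0 h1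
    exact (abs_sub _ _).trans (add_le_add e1 e2)
  have hcover : ∀ m, val β '' S ⊆ ⋃ a, t m a := by
    rintro m _ ⟨s, ⟨hs, hsw⟩, rfl⟩
    choose a ha using hsw
    exact Set.mem_iUnion.2 ⟨fun r => a r, s, ⟨hs, fun r i hi => ha r i hi⟩, rfl⟩
  have hlim : Filter.Tendsto (fun m : ℕ => ENNReal.ofReal (D * (β ^ L) ^ m)) Filter.atTop
      (nhds 0) := by
    have : Filter.Tendsto (fun m : ℕ => D * (β ^ L) ^ m) Filter.atTop (nhds 0) := by
      simpa using (tendsto_pow_atTop_nhds_zero_of_lt_one (by positivity)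
        (pow_lt_one₀ h0.le h1 hL.ne')).const_mul D
    simpa using ENNReal.tendsto_ofReal this
  have hsum : ∀ m, ∑ a, Metric.ediam (t m a) ^ (d : ℝ) ≤ ENNReal.ofReal (D ^ (d : ℝ)) := by
    intro m
    calc ∑ a, Metric.ediam (t m a) ^ (d : ℝ)
        ≤ ∑ _a : Fin m → ι, ENNReal.ofReal ((D * (β ^ L) ^ m) ^ (d : ℝ)) := by
          refine Finset.sum_le_sum fun a _ => ?_
          rw [← ENNReal.ofReal_rpow_of_nonneg (by positivity) d.coe_nonneg]
          exact ENNReal.rpow_le_rpow (hdiam m a) d.coe_nonneg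
      _ = ENNReal.ofReal (Fintype.card ι ^ m * (D * (β ^ L) ^ m) ^ (d : ℝ)) := by
          rw [Finset.sum_const, Finset.card_univ, nsmul_eq_mul, ENNReal.ofReal_mul (by positivity),
            Fintype.card_fun, Fintype.card_fin, ← Nat.cast_pow, ENNReal.ofReal_natCast]
      _ ≤ _ := by
          refine ENNReal.ofReal_le_ofReal ?_
          have e : ((β ^ L) ^ m) ^ (d : ℝ) = ((β ^ L) ^ (d : ℝ)) ^ m := by
            rw [← Real.rpow_natCast, ← Real.rpow_mul (by positivity), mul_comm,
              Real.rpow_mul (by positivity), Real.rpow_natCast]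
          rw [Real.mul_rpow hD0 (by positivity), e]
          calc (Fintype.card ι : ℝ) ^ m * (D ^ (d : ℝ) * ((β ^ L) ^ (d : ℝ)) ^ m)
              = D ^ (d : ℝ) * (Fintype.card ι * (β ^ L) ^ (d : ℝ)) ^ m := by
                rw [mul_pow]; ring
            _ ≤ D ^ (d : ℝ) * 1 := by
                refine mul_le_mul_of_nonneg_left ?_ (by positivity)
                exact pow_le_one₀ (by positivity) hd
            _ = _ := mul_one _
  refine dimH_le_of_hausdorffMeasure_ne_top
    (ne_top_of_le_ne_top (ENNReal.ofReal_ne_top (r := D ^ (d : ℝ))) ?_)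
  refine (MeasureTheory.Measure.hausdorffMeasure_le_liminf_sum (d : ℝ) (val β '' S) _ hlim t
    (Filter.Eventually.of_forall hdiam) (Filter.Eventually.of_forall hcover)).trans ?_
  refine (Filter.liminf_le_liminf (Filter.Eventually.of_forall hsum)).trans ?_
  rw [Filter.liminf_const]

/-- Prepending finitely many terms does not increase the dimension of a set of values. -/
theorem dimH_image_val_shift_le (C : ℤ) {β : ℝ} (h0 : 0 < β) (h1 : β < 1) (S : Set (ℕ → ℤ))
    (k : ℕ) : dimH (val β '' {s | BddBy C s ∧ shift k s ∈ S}) ≤ dimH (val β '' S) := by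
  let f : (Fin k → ℤ) → ℝ → ℝ := fun p v => ∑ i : Fin k, (p i : ℝ) * β ^ (i : ℕ) + β ^ k * v
  have hf : ∀ p, LipschitzWith ‖β ^ k‖₊ (f p) := fun p =>
    LipschitzWith.of_dist_le_mul fun v w => by
      simp only [f, Real.dist_eq, add_sub_add_left_eq_sub, ← mul_sub, abs_mul]
      rfl
  have hsub : val β '' {s | BddBy C s ∧ shift k s ∈ S} ⊆ ⋃ p, f p '' (val β '' S) := by
    rintro _ ⟨s, ⟨hs, hmem⟩, rfl⟩
    refine Set.mem_iUnion.2 ⟨fun i => s i, val β (shift k s), ⟨_, hmem, rfl⟩, ?_⟩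
    rw [hs.val_split h0 h1 k, Finset.sum_range]
  refine (dimH_mono hsub).trans ?_
  rw [dimH_iUnion]
  exact iSup_le fun p => (hf p).dimH_image_le _

theorem dimH_uniqueCodeSet_eq_zero {N : ℕ} {β : ℝ} (h : Admissible N β)
    (hc : threshold N β ≤ val β (mu N)) : dimH (uniqueCodeSet N β) = 0 := by
  have h0 := h.pos
  have h1 := h.lt_one
  have hN := h.two_le
  refine nonpos_iff_eq_zero.1 (le_of_forall_gt fun c hcpos => ?_)
  obtain ⟨d, hd0, hdc⟩ := ENNReal.lt_iff_exists_nnreal_btwn.1 hcpos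
  refine lt_of_le_of_lt ?_ hdc
  have hd0' : 0 < (d : ℝ) := by exact_mod_cast hd0
  -- blocks so long that the four kinds of them give dimension at most `d`
  obtain ⟨n, hn⟩ := exists_pow_lt_of_lt_one (by norm_num : (0 : ℝ) < 1 / 4)
    (Real.rpow_lt_one h0.le h1 hd0')
  have hcard : (Fintype.card (ℤˣ × Bool) : ℝ) * (β ^ 2 ^ n) ^ (d : ℝ) ≤ 1 := by
    have e : (β ^ 2 ^ n) ^ (d : ℝ) = (β ^ (d : ℝ)) ^ 2 ^ n := by
      rw [← Real.rpow_natCast, ← Real.rpow_mul h0.le, mul_comm, Real.rpow_mul h0.le,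
        Real.rpow_natCast]
    have h2 : (β ^ (d : ℝ)) ^ 2 ^ n ≤ (β ^ (d : ℝ)) ^ n :=
      pow_le_pow_of_le_one (by positivity) (Real.rpow_lt_one h0.le h1 hd0').le
        Nat.lt_two_pow_self.le
    have h3 : (Fintype.card (ℤˣ × Bool) : ℝ) = 4 := by
      rw [Fintype.card_prod, Fintype.card_units_int, Fintype.card_bool]
      norm_num
    rw [e, h3]
    linarith
  set B : Set (ℕ → ℤ) :=
    {s | BddBy (N - 1) s ∧ ∀ m, ∃ a, ∀ i < 2 ^ n, s (i + m * 2 ^ n) = block N n a i} with hB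
  have hdimB := dimH_image_val_blocks_le (block N n) (by positivity : 0 < 2 ^ n) h0 h1
    (by omega : (0 : ℤ) ≤ N - 1) hcard
  set Z : Set (ℕ → ℤ) := {fun _ => (N : ℤ) - 1, fun _ => -((N : ℤ) - 1)} ∪
    {s | ∃ k, shift k s ∈ eventuallyPeriodic N} with hZ
  have hZc : Z.Countable := (Set.toFinite _).countable.union
    (countable_setOf_shift_mem (countable_eventuallyPeriodic N))
  have hsub : {s | Univoque N β s} ⊆ Z ∪ ⋃ k, {s | BddBy (N - 1) s ∧ shift k s ∈ B} := by
    intro s hs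
    rcases univoque_subset h hs with h2 | ⟨hb, k, hk⟩
    · exact Or.inl (Or.inl h2)
    · have hlex := hk.lexBounded h hc
      rcases hlex.occurs_or_mem n with ⟨l, e, ho⟩ | hmem
      · right
        refine Set.mem_iUnion.2 ⟨l + k, hb, hb.shift _, fun m => ?_⟩
        obtain ⟨a, ha⟩ := hlex.eq_block ho m
        refine ⟨a, fun i hi => ?_⟩
        rw [← ha i hi]
        simp only [shift, add_assoc]
      · exact Or.inl (Or.inr ⟨k, hmem⟩)
  have hval : dimH (val β '' {s | Univoque N β s}) ≤ d := by
    refine (dimH_mono (Set.image_mono hsub)).trans ?_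
    rw [Set.image_union, Set.image_iUnion, dimH_union, dimH_countable (hZc.image _), dimH_iUnion]
    refine max_le zero_le (iSup_le fun k => ?_)
    exact (dimH_image_val_shift_le _ h0 h1 B k).trans hdimB
  have hlip : LipschitzWith ‖(radius N β)⁻¹‖₊ fun v : ℝ => v / radius N β :=
    LipschitzWith.of_dist_le_mul fun v w => by
      rw [Real.dist_eq, ← sub_div, div_eq_inv_mul, abs_mul]
      rfl
  have himg : uniqueCodeSet N β =
      (fun v : ℝ => v / radius N β) '' (val β '' {s | Univoque N β s}) := by
    rw [uniqueCodeSet_eq_image h, Set.image_image]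
    rfl
  rw [himg]
  exact (hlip.dimH_image_le _).trans hval

/-! ### The critical parameter: cardinality of the continuum -/

theorem BddBy.mono {C D : ℤ} {s : ℕ → ℤ} (h : BddBy C s) (hCD : C ≤ D) : BddBy D s :=
  fun i => (h i).trans hCD

theorem TailsLe.mono {l m : ℕ} {x : ℕ → Bool} (h : TailsLe m x) (hlm : l ≤ m) : TailsLe l x :=
  fun n i hi => h n i (by omega)

/-- For a difference sequence, all bounds on tails are one-sided bounds on `normTail`. -/
theorem trapped_diff_iff {N : ℕ} {β : ℝ} (h : Admissible N β) {x : ℕ → Bool} :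
    Trapped N β (diff x) ↔ ∀ n, (1 - β) * bval β (normTail x n) < β * threshold N β := by
  have hN := h.two_le
  constructor
  · intro hx n
    rw [← mul_abs_val_shift_diff h.pos h.lt_one]
    exact mul_lt_mul_of_pos_left (hx.abs_val_lt n) h.pos
  · intro hx
    refine ⟨(bddBy_diff x).mono (by omega), fun n => ?_⟩
    have := hx n
    rw [← mul_abs_val_shift_diff h.pos h.lt_one] at this
    exact lt_of_mul_lt_mul_left this h.pos.le

/-- The infinite composition of `subst` (where `c` is `false`) and `dup ∘ subst` (where `c` is
`true`), with first term `false`. -/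
def substLimit (c : ℕ → Bool) (n : ℕ) : Bool :=
  if n = 0 then false
  else if c 0 then xor (substLimit (shift 1 c) ((n - 1) / 2)) (decide ((n - 1) % 2 = 1))
  else xor (substLimit (shift 1 c) (n / 2)) (decide (n % 2 = 1))
  termination_by n
  decreasing_by all_goals omega

theorem substLimit_zero (c : ℕ → Bool) : substLimit c 0 = false := by
  rw [substLimit]
  simp

theorem substLimit_of_true {c : ℕ → Bool} (hc : c 0 = true) :
    substLimit c = dup (subst (substLimit (shift 1 c))) := by
  funext n
  rcases Nat.eq_zero_or_pos n with rfl | hn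
  · simp [substLimit_zero, dup, subst]
  · rw [substLimit, if_neg hn.ne', if_pos hc]
    rfl

theorem substLimit_of_false {c : ℕ → Bool} (hc : c 0 = false) :
    substLimit c = subst (substLimit (shift 1 c)) := by
  funext n
  rcases Nat.eq_zero_or_pos n with rfl | hn
  · simp [substLimit_zero, subst]
  · rw [substLimit, if_neg hn.ne', if_neg (by simp [hc])]
    rfl

theorem tailsLe_substLimit (c : ℕ → Bool) (l : ℕ) : TailsLe l (substLimit c) := by
  have key : ∀ m c, TailsLe (3 * 2 ^ m) (substLimit c) := by
    intro m
    induction m with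
    | zero => exact fun c => tailsLe_three _
    | succ m ih =>
      intro c
      rw [pow_succ, ← mul_assoc, mul_comm _ 2]
      cases hc : c 0
      · rw [substLimit_of_false hc]
        exact (ih _).subst
      · rw [substLimit_of_true hc]
        exact (ih _).subst.dup
  have : l < 2 ^ l := Nat.lt_two_pow_self
  exact (key l c).mono (by omega)

theorem subst_injective : Function.Injective subst := by
  intro x y he
  funext n
  simpa [subst] using congrFun he (2 * n)

theorem dup_injective : Function.Injective dup := by
  intro x y he
  funext n
  exact congrFun he (n + 1)

theorem substLimit_one (c : ℕ → Bool) : substLimit c 1 = !c 0 := by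
  cases hc : c 0
  · rw [substLimit_of_false hc]
    simp [subst, substLimit_zero]
  · rw [substLimit_of_true hc]
    simp [dup, subst, substLimit_zero]

theorem substLimit_injective : Function.Injective substLimit := by
  have key : ∀ n c c', substLimit c = substLimit c' → c n = c' n := by
    intro n
    induction n with
    | zero =>
      intro c c' he
      have := congrFun he 1
      rw [substLimit_one, substLimit_one] at this
      simpa using this
    | succ n ih =>
      intro c c' he
      have h0 : c 0 = c' 0 := by
        have := congrFun he 1
        rw [substLimit_one, substLimit_one] at this
        simpa using this
      refine ih (shift 1 c) (shift 1 c') ?_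
      cases hc : c 0
      · rw [substLimit_of_false hc, substLimit_of_false (c := c') (h0.symm.trans hc)] at he
        exact subst_injective he
      · rw [substLimit_of_true hc, substLimit_of_true (c := c') (h0.symm.trans hc)] at he
        exact subst_injective (dup_injective he)
  exact fun c c' he => funext fun n => key n c c' he

/-- A binary sequence that starts with `false` is determined by its difference sequence. -/
theorem diff_injOn : Set.InjOn diff {x | x 0 = false} := by
  intro x hx y hy he
  funext n
  induction n with
  | zero => exact Eq.trans hx (Eq.symm hy)
  | succ n ih =>
    have := congrFun he n
    rw [diff, diff, ih, sub_left_inj] at this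
    revert this
    cases x (n + 1) <;> cases y (n + 1) <;> simp

theorem mk_uniqueCodeSet_eq_continuum {N : ℕ} {β : ℝ} (h : Admissible N β)
    (hc : threshold N β = val β (mu N)) : #(uniqueCodeSet N β) = 𝔠 := by
  have h0 := h.pos
  have h1 := h.lt_one
  refine le_antisymm ((Cardinal.mk_set_le _).trans Cardinal.mk_real.le) ?_
  -- The sequences for which some tail attains the bound; only countably many, since their
  -- tails are among two sequences.
  set bad : Set (ℕ → Bool) :=
    substLimit ⁻¹' {x | ∃ k, shift k x ∈ ({thueMorse, fun i => !thueMorse i} : Set _)} with hbad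
  have hcount : bad.Countable :=
    (countable_setOf_shift_mem (Set.toFinite _).countable).preimage_of_injOn
      substLimit_injective.injOn
  have htrap : ∀ c ∈ badᶜ, Trapped N β (diff (substLimit c)) := by
    intro c hcb
    rw [trapped_diff_iff h]
    intro n
    rw [hc, mul_val_mu N h0 h1]
    refine mul_lt_mul_of_pos_left ?_ (by linarith)
    refine bval_lt_of_lexLe (fun l => tailsLe_substLimit c l n) (fun he => hcb ⟨n, ?_⟩) h0 h.lt_half
    cases hx : substLimit c n
    · left
      rw [← he]
      funext i
      simp [normTail, hx, shift]
    · right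
      rw [Set.mem_singleton_iff, ← he]
      funext i
      simp [normTail, hx, shift]
  have hcard : #(ℕ → Bool) = 𝔠 := by simp
  have hcompl : #(badᶜ : Set (ℕ → Bool)) = 𝔠 := by
    rw [← hcard]
    refine Cardinal.mk_compl_of_infinite _ ?_
    rw [hcard]
    exact hcount.le_aleph0.trans_lt Cardinal.aleph0_lt_continuum
  rw [← hcompl, uniqueCodeSet_eq_image h]
  refine Cardinal.mk_le_of_injective
    (f := fun c => ⟨codePoint N β (diff (substLimit c.1)), _, (htrap c.1 c.2).univoque, rfl⟩) ?_
  rintro ⟨c, hcb⟩ ⟨c', hcb'⟩ he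
  have e1 := codePoint_injOn h (htrap c hcb).univoque (htrap c' hcb').univoque
    (Subtype.mk.inj he)
  exact Subtype.ext (substLimit_injective
    (diff_injOn (substLimit_zero c) (substLimit_zero c') e1))

/-! ### Parameters below the critical one: positive dimension -/

/-- If sequences of binary digits that first differ at place `n` have images at distance at least
`a * b ^ n`, then the inverse of the map, followed by the evaluation of binary expansions, is
Hölder continuous, and it maps onto an interval. -/
theorem dimH_range_pos {g : (ℕ → Fin 2) → ℝ} {a b : ℝ} (ha : 0 < a) (hb0 : 0 < b) (hb1 : b < 1)
    (hg : ∀ z z' n, (∀ k < n, z k = z' k) → z n ≠ z' n → a * b ^ n ≤ |g z - g z'|) :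
    0 < dimH (Set.range g) := by
  have hinj : Function.Injective g := by
    intro z z' he
    by_contra hne
    obtain ⟨n, hn, hne⟩ := exists_first_ne hne
    have := hg z z' n hn hne
    rw [he, sub_self, abs_zero] at this
    have : 0 < a * b ^ n := by positivity
    linarith
  have hlog : Real.log b < 0 := Real.log_neg hb0 hb1
  -- the exponent with `b ^ ρ = 1 / 2`
  set ρ : ℝ := Real.log (1 / 2) / Real.log b with hρ
  have hρ0 : 0 < ρ := div_pos_of_neg_of_neg (Real.log_neg (by norm_num) (by norm_num)) hlog
  have hbρ : b ^ ρ = 1 / 2 := by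
    rw [Real.rpow_def_of_pos hb0, hρ, mul_div_cancel₀ _ hlog.ne, Real.exp_log (by norm_num)]
  let f : ℝ → ℝ := fun t => Real.ofDigits (Function.invFun g t)
  have hfg : ∀ z, f (g z) = Real.ofDigits z := fun z => by
    simp only [f]
    rw [Function.leftInverse_invFun hinj z]
  have hholder : HolderOnWith (Real.toNNReal ((a ^ ρ)⁻¹)) (Real.toNNReal ρ) f (Set.range g) := by
    rintro _ ⟨z, rfl⟩ _ ⟨z', rfl⟩
    by_cases hzz : z = z'
    · simp [hzz]
    obtain ⟨n, hn, hne⟩ := exists_first_ne hzz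
    have e1 := hg z z' n hn hne
    have e2 := Real.abs_ofDigits_sub_ofDigits_le hn
    rw [hfg, hfg, edist_dist, edist_dist, Real.dist_eq, Real.dist_eq, Real.coe_toNNReal _ hρ0.le,
      ENNReal.ofReal_rpow_of_nonneg (abs_nonneg _) hρ0.le]
    change _ ≤ ENNReal.ofReal _ * _
    rw [← ENNReal.ofReal_mul (by positivity)]
    refine ENNReal.ofReal_le_ofReal (e2.trans ?_)
    rw [← div_eq_inv_mul, le_div_iff₀ (by positivity)]
    have e3 : ((2 : ℕ) ^ n : ℝ)⁻¹ = (b ^ n) ^ ρ := by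
      rw [← Real.rpow_natCast b n, ← Real.rpow_mul hb0.le, mul_comm, Real.rpow_mul hb0.le, hbρ,
        Real.rpow_natCast]
      simp
    calc ((2 : ℕ) ^ n : ℝ)⁻¹ * a ^ ρ = (a * b ^ n) ^ ρ := by
          rw [e3, Real.mul_rpow ha.le (by positivity), mul_comm]
      _ ≤ _ := Real.rpow_le_rpow (by positivity) e1 hρ0.le
  have himg : Set.Icc (0 : ℝ) 1 ⊆ f '' Set.range g := by
    intro t ht
    obtain ⟨z, -, hz⟩ := Real.ofDigits_SurjOn (b := 2) (by norm_num) ht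
    exact ⟨g z, ⟨z, rfl⟩, (hfg z).trans hz⟩
  have hone : dimH (Set.Icc (0 : ℝ) 1) = 1 := by
    rw [Real.dimH_of_nonempty_interior (by rw [interior_Icc]; exact ⟨1 / 2, by norm_num⟩)]
    simp
  have h2 := (dimH_mono himg).trans (hholder.dimH_image_le (Real.toNNReal_pos.2 hρ0))
  rw [hone] at h2
  rw [pos_iff_ne_zero]
  intro hz
  rw [hz, ENNReal.zero_div] at h2
  exact absurd h2 (by norm_num)

theorem subst_iterate_agree {m n : ℕ} {x y : ℕ → Bool} (h : ∀ k < n, x k = y k) :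
    ∀ k < 2 ^ m * n, subst^[m] x k = subst^[m] y k := by
  induction m with
  | zero => simpa using h
  | succ m ih =>
    intro k hk
    rw [pow_succ] at hk
    rw [Function.iterate_succ_apply', Function.iterate_succ_apply', subst, subst,
      ih (k / 2) (by
        have : 2 ^ m * 2 * n = 2 * (2 ^ m * n) := by ring
        omega)]

theorem subst_iterate_mul (m n : ℕ) (x : ℕ → Bool) : subst^[m] x (2 ^ m * n) = x n := by
  induction m with
  | zero => simp
  | succ m ih =>
    have e : 2 ^ (m + 1) * n = 2 * (2 ^ m * n) := by ring
    rw [Function.iterate_succ_apply', e]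
    simpa [subst] using ih

/-- The binary sequence `false, z_0, z_1, …`. -/
def consFalse (z : ℕ → Fin 2) : ℕ → Bool
  | 0 => false
  | n + 1 => decide (z n = 1)

/-- For large `m` the images of *all* binary sequences under `subst^[m]` have trapped difference
sequences, since their tails obey the Thue–Morse bound for `3 * 2 ^ m` places. -/
theorem dimH_uniqueCodeSet_pos {N : ℕ} {β : ℝ} (h : Admissible N β)
    (hc : val β (mu N) < threshold N β) : 0 < dimH (uniqueCodeSet N β) := by
  have h0 := h.pos
  have h1 := h.lt_one
  have h2 := h.lt_half
  have hR := h.radius_pos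
  obtain ⟨m, hm⟩ := exists_pow_lt_of_lt_one (mul_pos h0 (sub_pos.2 hc)) h1
  have htrap : ∀ x, Trapped N β (diff (subst^[m] x)) := by
    intro x
    rw [trapped_diff_iff h]
    intro n
    have h3 := (tailsLe_iterate_subst x m n).bval_le h0 h2
    have h4 : β ^ (3 * 2 ^ m) ≤ β ^ m := pow_le_pow_of_le_one h0.le h1.le (by
      have : m < 2 ^ m := Nat.lt_two_pow_self
      omega)
    have h5 := mul_le_mul_of_nonneg_left h3 (by linarith : 0 ≤ 1 - β)
    have h6 : 1 - β ≠ 0 := by linarith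
    rw [mul_add, mul_div_cancel₀ _ h6, ← mul_val_mu N h0 h1] at h5
    linarith
  let g : (ℕ → Fin 2) → ℝ := fun z => codePoint N β (diff (subst^[m] (consFalse z)))
  have hrange : Set.range g ⊆ uniqueCodeSet N β := by
    rw [uniqueCodeSet_eq_image h]
    rintro _ ⟨z, rfl⟩
    exact ⟨_, (htrap _).univoque, rfl⟩
  refine lt_of_lt_of_le ?_ (dimH_mono hrange)
  have hg : ∀ z, g z = (1 - β) / (β * radius N β) * bval β (subst^[m] (consFalse z)) := by
    intro z
    have e := mul_val_diff h0 h1 (subst^[m] (consFalse z))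
    have e2 : subst^[m] (consFalse z) 0 = false := by
      simpa [consFalse] using subst_iterate_mul m 0 (consFalse z)
    rw [e2] at e
    simp only [Bool.toInt_false, Int.cast_zero, sub_zero] at e
    simp only [g, codePoint]
    rw [div_mul_eq_mul_div, ← e]
    field_simp
  set A : ℝ := (1 - β) / (β * radius N β) with hA
  have hA0 : 0 < A := div_pos (by linarith) (by positivity)
  set B : ℝ := (1 - 2 * β) / (1 - β) with hB
  have hB0 : 0 < B := div_pos (by linarith) (by linarith)
  refine dimH_range_pos (a := A * (β ^ 2 ^ m * B)) (b := β ^ 2 ^ m) (by positivity)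
    (by positivity) (pow_lt_one₀ h0.le h1 (by positivity)) fun z z' n hn hne => ?_
  rw [hg, hg, ← mul_sub, abs_mul, abs_of_pos hA0]
  have e : A * (β ^ 2 ^ m * B) * (β ^ 2 ^ m) ^ n = A * (β ^ (2 ^ m * (n + 1)) * B) := by
    rw [pow_mul]
    ring
  rw [e]
  refine mul_le_mul_of_nonneg_left ?_ hA0.le
  have hag : ∀ k < n + 1, consFalse z k = consFalse z' k := by
    intro k hk
    cases k with
    | zero => rfl
    | succ k => rw [consFalse, consFalse, hn k (by omega)]
  have hag' := subst_iterate_agree (m := m) hag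
  have ev : ∀ w, subst^[m] (consFalse w) (2 ^ m * (n + 1)) = decide (w n = 1) := fun w =>
    subst_iterate_mul m (n + 1) (consFalse w)
  have hcases : (z n = 0 ∧ z' n = 1) ∨ (z n = 1 ∧ z' n = 0) := by
    revert hne
    generalize z n = p
    generalize z' n = q
    revert p q
    decide
  rcases hcases with ⟨hz, hz'⟩ | ⟨hz, hz'⟩
  · rw [abs_sub_comm]
    refine le_trans ?_ (le_abs_self _)
    exact le_bval_sub_bval h0 h1 hag' (by rw [ev, hz]; rfl) (by rw [ev, hz']; rfl)
  · refine le_trans ?_ (le_abs_self _)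
    exact le_bval_sub_bval h0 h1 (fun k hk => (hag' k hk).symm) (by rw [ev, hz']; rfl)
      (by rw [ev, hz]; rfl)

/-! ### The three regimes -/

theorem theorem4p3 (N : ℕ) (hN : 2 ≤ N) :
    ∃ βc : ℝ, βc ∈ Set.Ioo (1 / (2 * (N : ℝ) - 1)) (1 / (N : ℝ)) ∧
      HasSum (fun ℓ : ℕ => (lam N (ℓ + 1) : ℝ) * βc ^ (ℓ + 1)) 1 ∧
      (∀ b : ℝ, 0 < b → HasSum (fun ℓ : ℕ => (lam N (ℓ + 1) : ℝ) * b ^ (ℓ + 1)) 1 → b = βc) ∧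
      ∀ β : ℝ, β ∈ Set.Ioo (1 / (2 * (N : ℝ) - 1)) (1 / (N : ℝ)) →
        (β < βc → 0 < dimH (uniqueCodeSet N β)) ∧
        (β = βc → #(uniqueCodeSet N β) = 𝔠 ∧ dimH (uniqueCodeSet N β) = 0) ∧
        (βc < β → #(uniqueCodeSet N β) = ℵ₀) := by
  obtain ⟨c, hc, hsum⟩ := exists_critical N hN
  refine ⟨c, hc.mem, hsum, fun b hb hbs => ?_, fun β hβ => ?_⟩
  · rcases lt_trichotomy b c with hlt | heq | hlt
    · exact absurd (hasSum_lam_lt hN hb hlt hbs hsum) (lt_irrefl _)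
    · exact heq
    · exact absurd (hasSum_lam_lt hN hc.pos hlt hsum hbs) (lt_irrefl _)
  · have h : Admissible N β := ⟨hN, hβ⟩
    refine ⟨fun hlt => ?_, fun heq => ?_, fun hlt => ?_⟩
    · exact dimH_uniqueCodeSet_pos h (lt_threshold_of_lt_critical h hsum hlt)
    · subst heq
      have he := threshold_eq_of_critical h hsum
      exact ⟨mk_uniqueCodeSet_eq_continuum h he, dimH_uniqueCodeSet_eq_zero h he.le⟩
    · have hlt' := threshold_lt_of_critical_lt h hc.pos hsum hlt
      have := (infinite_uniqueCodeSet h).to_subtype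
      have := (countable_uniqueCodeSet h hlt').to_subtype
      exact Cardinal.mk_eq_aleph0 _
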